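/- Let $N\ge 1$ be an integer and let $\mathbf c:[0,L]\to\mathbb R^{N+1}$ be the arc-length parameterization of a rectifiable open curve, so that $L>0$ is its length and $\mathbf c(0)\neq\mathbf c(L)$. A polygonal $P$ inscribed in $\mathbf c$, written $P\ll\mathbf c$, is given by a partition $0=t_0<t_1<\dots<t_n=L$ with $\mathbf c(t_{i-1})\ne\mathbf c(t_i)$ for all $i$; its edges are $\mathbf v_i=\mathbf c(t_i)-\mathbf c(t_{i-1})$, of length $\ell_i=\|\mathbf v_i\|>0$ $(1\le i\le n)$, its turning angle at the vertex $v_i=\mathbf c(t_i)$ $(1\le i\le n-1)$ is the angle $\theta_i\in[0,\pi]$ between $\mathbf v_i$ and $\mathbf v_{i+1}$, and its modulus is $\mu_{\mathbf c}(P)=\max_{1\le i\le n}\operatorname{diam}\mathbf c([t_{i-1},t_i])$. If all $\theta_i<\pi$, let $r_i=\min\{\ell_i,\ell_{i+1}\}$ and let $t_i^-$, $t_i^+$ be the points of the segments $\mathbf v_i$, $\mathbf v_{i+1}$ at distance $r_i/2$ from $v_i$. Let $\gamma_i$ be the oriented circular arc from $t_i^-$ to $t_i^+$ that turns by the angle $\theta_i$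 and is tangent to $\mathbf v_i$ at $t_i^-$ and to $\mathbf v_{i+1}$ at $t_i^+$ (the segment from $t_i^-$ to $t_i^+$ if $\theta_i=0$). Let $\gamma(P)$ be the curve that runs consecutively through $\gamma_1$, the segment from $t_1^+$ to $t_2^-$, $\gamma_2$, and so on, up to $\gamma_{n-1}$. For $p>1$ put $$\mathbf k_p(P)=\int_{\gamma(P)}\mathfrak K^p\,ds,$$ where $s$ is the arc length and $\mathfrak K$ the scalar curvature of $\gamma(P)$ (the norm of the second derivative of its arc-length parameterization); put $\mathbf k_p(P)=+\infty$ if some $\theta_i=\pi$. The relaxed $p$-curvature of $\mathbf c$ is $$\mathcal F_p(\mathbf c)=\inf\Bigl\{\liminf_{h\to\infty}\mathbf k_p(P_h)\ \Big|\ P_h\ll\mathbf c \text{ for all } h,\ \ \mu_{\mathbf c}(P_h)\to 0\Bigr\}\in[0,+\infty].$$ Theorem. For every exponent $p>1$, $$\mathcal F_p(\mathbf c)<\infty\iff \mathbf c\in W^{2,p}\bigl((0,L),\mathbb R^{N+1}\bigr),$$ and in that case $$\mathcal F_p(\mathbf c)=\int_0^L\|\ddot{\mathbf c}(s)\|^p\,ds,$$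 where $\ddot{\mathbf c}$ is the weak second derivative of $\mathbf c$. -/

import Mathlib

open Set Filter Topology MeasureTheory
open scoped ENNReal ContDiff

namespace PCurvature

/-! ### Sobolev functions on an interval -/

section Sobolev

variable {E : Type*} [NormedAddCommGroup E] [NormedSpace ℝ E]

/-- `g` is a weak (distributional) derivative of order `k` of `u` on the open interval `(a, b)`. -/
def IsWeakDeriv (k : ℕ) (u g : ℝ → E) (a b : ℝ) : Prop :=
  LocallyIntegrableOn u (Ioo a b) ∧ LocallyIntegrableOn g (Ioo a b) ∧
    ∀ φ : ℝ → ℝ, ContDiff ℝ ∞ φ → HasCompactSupport φ → tsupport φ ⊆ Ioo a b →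
      ∫ s in Ioo a b, iteratedDeriv k φ s • u s = (-1 : ℝ) ^ k • ∫ s in Ioo a b, φ s • g s

/-- `u` belongs to the Sobolev space `W^{k,p}((a, b), E)`: for every `j ≤ k` it has a weak
derivative of order `j` on `(a, b)` which lies in `L^p((a, b), E)`. -/
def MemSobolev (k : ℕ) (p : ℝ≥0∞) (u : ℝ → E) (a b : ℝ) : Prop :=
  ∀ j ≤ k, ∃ g : ℝ → E, IsWeakDeriv j u g a b ∧ MemLp g p (volume.restrict (Ioo a b))

end Sobolev

/-! ### Curves made of finitely many consecutive arc-length parameterized pieces -/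

section Pieces

/-- A piece of a curve: the map `path`, to be considered on `[0, len]`. -/
structure Piece (E : Type*) where
  /-- the length of the piece -/
  len : ℝ
  /-- the arc-length parameterization of the piece, on `[0, len]` -/
  path : ℝ → E

/-- The length of a curve composed of consecutive pieces. -/
noncomputable def totalLength {E : Type*} (l : List (Piece E)) : ℝ :=
  (l.map Piece.len).sum

/-- The parameterization, on `[0, totalLength l]`, of the curve that runs consecutively through
the pieces of `l`. -/
noncomputable def concat {E : Type*} [Zero E] : List (Piece E) → ℝ → E
  | [] => fun _ => 0
  | a :: l => fun s => if s ≤ a.len then a.path s else concat l (s - a.len)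

end Pieces

section Polygonal

variable {E : Type*} [NormedAddCommGroup E] [InnerProductSpace ℝ E]

/-- The segment from `x` to `y`, parameterized by arc length. -/
noncomputable def segmentPiece (x y : E) : Piece E where
  len := dist x y
  path := fun s => x + (s / dist x y) • (y - x)

/-! ### The `p`-rotation of an open polygonal

The polygonal with `n` edges has the vertices `v 0, …, v n`. The `i`-th edge, `i < n`, goes from
`v i` to `v (i + 1)`. The `i`-th corner, `i + 1 < n`, is at the vertex `v (i + 1)`, where the
edges with numbers `i` and `i + 1` concur. -/

/-- The `i`-th edge as a vector. -/
def edge (v : ℕ → E) (i : ℕ) : E := v (i + 1) - v i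

/-- The unit vector in the direction of the `i`-th edge. -/
noncomputable def edgeDir (v : ℕ → E) (i : ℕ) : E := ‖edge v i‖⁻¹ • edge v i

/-- The turning (exterior) angle at the `i`-th corner. -/
noncomputable def turningAngle (v : ℕ → E) (i : ℕ) : ℝ :=
  InnerProductGeometry.angle (edge v i) (edge v (i + 1))

/-- The smaller of the lengths of the two edges concurring at the `i`-th corner. -/
noncomputable def cornerSize (v : ℕ → E) (i : ℕ) : ℝ :=
  min ‖edge v i‖ ‖edge v (i + 1)‖

/-- The point of the incoming edge at distance `cornerSize v i / 2` from the `i`-th corner. -/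
noncomputable def tMinus (v : ℕ → E) (i : ℕ) : E :=
  v (i + 1) - (cornerSize v i / 2) • edgeDir v i

/-- The point of the outgoing edge at distance `cornerSize v i / 2` from the `i`-th corner. -/
noncomputable def tPlus (v : ℕ → E) (i : ℕ) : E :=
  v (i + 1) + (cornerSize v i / 2) • edgeDir v (i + 1)

/-- The radius of the circle tangent to the two edges concurring at the `i`-th corner at
`tMinus v i` and `tPlus v i`. -/
noncomputable def arcRadius (v : ℕ → E) (i : ℕ) : ℝ :=
  (cornerSize v i / 2) / Real.tan (turningAngle v i / 2)

/-- The unit vector in the plane of the two edges concurring at the `i`-th corner that is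
orthogonal to the incoming edge and points to the side of the outgoing edge. -/
noncomputable def arcNormal (v : ℕ → E) (i : ℕ) : E :=
  (Real.sin (turningAngle v i))⁻¹ •
    (edgeDir v (i + 1) - Real.cos (turningAngle v i) • edgeDir v i)

open Classical in
/-- The oriented circular arc which replaces the `i`-th corner, when the turning angle `θ` is
lower than `π`. It goes from `tMinus v i` to `tPlus v i`, is tangent to the incoming edge at
`tMinus v i` and to the outgoing edge at `tPlus v i`, and turns by the angle `θ`. If `θ = 0`, it is
the segment from `tMinus v i` to `tPlus v i`. -/
noncomputable def arcPiece (v : ℕ → E) (i : ℕ) : Piece E :=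
  if turningAngle v i = 0 then segmentPiece (tMinus v i) (tPlus v i)
  else
    { len := arcRadius v i * turningAngle v i
      path := fun s => tMinus v i
        + (arcRadius v i * Real.sin (s / arcRadius v i)) • edgeDir v i
        + (arcRadius v i * (1 - Real.cos (s / arcRadius v i))) • arcNormal v i }

/-- The consecutive pieces of the smoothed curve `γ(P)` of the polygonal `P` with the `n` edges
given by `v`: the arc at corner `0`, the segment from there to the arc at corner `1`, the arc at
corner `1`, and so on, up to the arc at the last corner `n - 2`. -/
noncomputable def smoothingPieces (v : ℕ → E) (n : ℕ) : List (Piece E) :=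
  (List.range (n - 1)).flatMap fun i =>
    match i with
    | 0 => [arcPiece v 0]
    | j + 1 => [segmentPiece (tPlus v j) (tMinus v (j + 1)), arcPiece v (j + 1)]

open Classical in
/-- The `p`-rotation `k_p(P)` of the polygonal `P` with the `n` edges given by `v`: the integral of
the `p`-th power of the scalar curvature of the arc-length parameterization of `γ(P)`, and `+∞` if
some turning angle is equal to `π`. -/
noncomputable def pRotation (p : ℝ) (v : ℕ → E) (n : ℕ) : ℝ≥0∞ :=
  if ∃ i, i + 1 < n ∧ turningAngle v i = Real.pi then ⊤
  else ∫⁻ s in Ioo 0 (totalLength (smoothingPieces v n)),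
    ‖deriv (deriv (concat (smoothingPieces v n))) s‖ₑ ^ p

/-! ### Inscribed polygonals and the relaxed functional -/

/-- A polygonal inscribed in the curve `c : [0, L] → E`, given by a partition
`0 = t 0 < t 1 < ⋯ < t n = L`; its edges are nondegenerate. -/
structure InscribedPolygonal (c : ℝ → E) (L : ℝ) where
  /-- the number of edges -/
  n : ℕ
  /-- the points of the partition (only `t 0, …, t n` matter) -/
  t : ℕ → ℝ
  t_zero : t 0 = 0
  t_last : t n = L
  t_lt : ∀ i < n, t i < t (i + 1)
  nondegenerate : ∀ i < n, c (t i) ≠ c (t (i + 1))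

/-- The vertices of an inscribed polygonal. -/
def InscribedPolygonal.vertex {c : ℝ → E} {L : ℝ} (P : InscribedPolygonal c L) (i : ℕ) : E :=
  c (P.t i)

/-- The modulus `μ_c(P)`: the maximum of the diameters of the arcs of `c` determined by the
consecutive vertices of `P`. -/
noncomputable def InscribedPolygonal.modulus {c : ℝ → E} {L : ℝ} (P : InscribedPolygonal c L) :
    ℝ≥0∞ :=
  ⨆ i ∈ Finset.range P.n, Metric.ediam (c '' Icc (P.t i) (P.t (i + 1)))

/-- The `p`-curvature (relaxed `p`-energy) `F_p(c)` of the open curve `c : [0, L] → E`. -/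
noncomputable def pCurvature (p : ℝ) (c : ℝ → E) (L : ℝ) : ℝ≥0∞ :=
  ⨅ (P : ℕ → InscribedPolygonal c L) (_ : Tendsto (fun h => (P h).modulus) atTop (𝓝 0)),
    liminf (fun h => pRotation p (P h).vertex (P h).n) atTop

end Polygonal

end PCurvature

/-! On an arc of radius `R` turning by `θ` the energy is `R θ · R⁻ᵖ`, and `1 / R = 2 tan (θ / 2) /
r`. Straight pieces contribute nothing, so the `p`-rotation of a polygonal is the finite sum of the
terms `θ (2 tan (θ / 2) / r) ^ (p - 1)` (`pRotation_eq_sum`). The theorem follows from two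
inequalities.

Lower bound. Since `2 tan (θ / 2) ≥ θ`, each term is at least `r (θ / r) ^ p`. Hölder with weights
`r` bounds the change of edge direction between two edges: its `p`-th power is at most the energy
accumulated between them times the `(p - 1)`-th power of the length between them. Take polygonals
with modulus tending to zero and energies bounded by `M`. Their lengths tend to `L`, so their
parameter meshes tend to zero, and along an ultrafilter the directions converge to some `u` and the
accumulated energies to a nondecreasing `F`, with `‖Δu‖ ^ p ≤ ΔF · Δ ^ (p - 1)` (`exists_tangent`).
Hence `u` is absolutely continuous and `‖u'‖ ^ p ≤ F'` almost everywhere, so `∫ ‖u'‖ ^ p ≤ F L - F 0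
≤ M` (`DominatedIncrements.exists_isPrimitive`). Summing edges shows that `u` is the derivative of
`c`.

Upper bound. If `c' = u` is a primitive of `g ∈ L^p`, inscribe polygonals at uniform step `h`.
Continuity of `u` makes every edge nearly as long as `h` and every angle small, so a corner costs at
most `(1 + o(1)) h ^ (1 - 2p)` times the `p`-th power of the second difference of `c`
(`cornerEnergy_le`). Two applications of Hölder and Tonelli bound the sum of those powers by `h ^
(2p - 1) ∫ ‖g‖ ^ p` (`sum_second_difference_le`). -/

namespace PCurvature

/-! ### Weak derivatives and indefinite integrals on an interval -/

section WeakDerivatives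

variable {E : Type*} [NormedAddCommGroup E]

section NormedSpace

variable [NormedSpace ℝ E] {u v g g₁ g₂ : ℝ → E} {a b L : ℝ} {k : ℕ}

lemma integrableOn_smul_of_locallyIntegrableOn {φ : ℝ → ℝ} (hφ : Continuous φ)
    (hc : HasCompactSupport φ) (hs : tsupport φ ⊆ Ioo a b) (hg : LocallyIntegrableOn g (Ioo a b)) :
    IntegrableOn (fun s => φ s • g s) (Ioo a b) := by
  have h1 : IntegrableOn g (tsupport φ) := hg.integrableOn_compact_subset hs hc
  have h2 : IntegrableOn (fun s => φ s • g s) (tsupport φ) :=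
    h1.continuousOn_smul hφ.continuousOn hc
  refine (integrableOn_iff_integrable_of_support_subset ?_).1 h2 |>.integrableOn
  intro s hs'
  by_contra hns
  exact hs' (by simp [image_eq_zero_of_notMem_tsupport hns])

lemma setIntegral_eq_integral_of_tsupport_subset {φ : ℝ → ℝ} (hs : tsupport φ ⊆ Ioo a b)
    (g : ℝ → E) : ∫ s in Ioo a b, φ s • g s = ∫ s, φ s • g s := by
  refine setIntegral_eq_integral_of_forall_compl_eq_zero fun s hns => ?_
  rw [image_eq_zero_of_notMem_tsupport fun h => hns (hs h), zero_smul]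

lemma IsWeakDeriv.ae_eq [CompleteSpace E] (h₁ : IsWeakDeriv k u g₁ a b)
    (h₂ : IsWeakDeriv k u g₂ a b) : ∀ᵐ s, s ∈ Ioo a b → g₁ s = g₂ s := by
  have key := isOpen_Ioo.ae_eq_zero_of_integral_contDiff_smul_eq_zero
    (μ := volume) (f := fun s => g₁ s - g₂ s) (U := Ioo a b) (h₁.2.1.sub h₂.2.1) ?_
  · filter_upwards [key] with s hs hs'
    exact sub_eq_zero.1 (hs hs')
  · intro φ hφ hc hs
    have e := (h₁.2.2 φ hφ hc hs).symm.trans (h₂.2.2 φ hφ hc hs)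
    have e' := (smul_right_injective E (pow_ne_zero k (by norm_num : (-1 : ℝ) ≠ 0))) e
    rw [← setIntegral_eq_integral_of_tsupport_subset hs]
    simp_rw [smul_sub]
    rw [integral_sub (integrableOn_smul_of_locallyIntegrableOn hφ.continuous hc hs h₁.2.1)
      (integrableOn_smul_of_locallyIntegrableOn hφ.continuous hc hs h₂.2.1), e', sub_self]

lemma IsWeakDeriv.trans (h₁ : IsWeakDeriv 1 u v a b) (h₂ : IsWeakDeriv 1 v g a b) :
    IsWeakDeriv 2 u g a b := by
  refine ⟨h₁.1, h₂.2.1, fun φ hφ hc hs => ?_⟩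
  have hφ' : ContDiff ℝ ∞ (deriv φ) := (contDiff_infty_iff_deriv.1 hφ).2
  have e1 := h₁.2.2 (deriv φ) hφ' hc.deriv ((tsupport_deriv_subset (𝕜 := ℝ)).trans hs)
  have e2 := h₂.2.2 φ hφ hc hs
  simp only [iteratedDeriv_succ, iteratedDeriv_zero, pow_one, neg_smul, one_smul]
    at e1 e2 ⊢
  rw [e1, e2]
  simp

lemma IsWeakDeriv.of_order_two (h₁ : IsWeakDeriv 1 u v a b) (h₂ : IsWeakDeriv 2 u g a b) :
    IsWeakDeriv 1 v g a b := by
  refine ⟨h₁.2.1, h₂.2.1, fun φ hφ hc hs => ?_⟩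
  have hφ' : ContDiff ℝ ∞ (deriv φ) := (contDiff_infty_iff_deriv.1 hφ).2
  have e1 := h₁.2.2 (deriv φ) hφ' hc.deriv ((tsupport_deriv_subset (𝕜 := ℝ)).trans hs)
  have e2 := h₂.2.2 φ hφ hc hs
  simp only [iteratedDeriv_succ, iteratedDeriv_zero, pow_one, neg_smul, one_smul]
    at e1 e2 ⊢
  rw [e1] at e2
  rw [← neg_eq_iff_eq_neg, e2]
  simp

/-- A smooth function with compact support in `(a, b)` and vanishing integral is the derivative of
such a function. -/
lemma exists_primitive_test {χ : ℝ → ℝ} (hχ : ContDiff ℝ ∞ χ) (hc : HasCompactSupport χ)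
    (hs : tsupport χ ⊆ Ioo a b) (h0 : ∫ s, χ s = 0) :
    ∃ η : ℝ → ℝ, ContDiff ℝ ∞ η ∧ HasCompactSupport η ∧ tsupport η ⊆ Ioo a b ∧ deriv η = χ := by
  rcases (tsupport χ).eq_empty_or_nonempty with he | hne
  · refine ⟨0, contDiff_const, HasCompactSupport.zero, ?_, ?_⟩
    · simp [tsupport]
    · rw [tsupport_eq_empty_iff.1 he]
      ext x; simp
  have hmin := hc.isCompact.sInf_mem hne
  have hmax := hc.isCompact.sSup_mem hne
  set α := sInf (tsupport χ)
  set β := sSup (tsupport χ)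
  have hsub : tsupport χ ⊆ Icc α β := fun x hx =>
    ⟨csInf_le hc.isCompact.bddBelow hx, le_csSup hc.isCompact.bddAbove hx⟩
  have hzero : ∀ x, x ∉ Icc α β → χ x = 0 := fun x hx =>
    image_eq_zero_of_notMem_tsupport fun h => hx (hsub h)
  have hder : ∀ x, HasDerivAt (fun s => ∫ r in α..s, χ r) (χ x) x := fun x =>
    hχ.continuous.integral_hasStrictDerivAt α x |>.hasDerivAt
  have hderiv : deriv (fun s => ∫ r in α..s, χ r) = χ := funext fun x => (hder x).deriv
  have hαβ : α ≤ β := (hsub hmin).2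
  have hsupp : Function.support (fun s => ∫ r in α..s, χ r) ⊆ Icc α β := by
    intro x hx
    by_contra hnx
    apply hx
    rcases not_and_or.1 hnx with h | h
    · have h := not_le.1 h
      refine (intervalIntegral.integral_congr_uIoo (g := fun _ => (0 : ℝ)) fun r hr => ?_).trans
        (by simp)
      rw [uIoo_of_ge h.le] at hr
      exact hzero r fun h' => absurd hr.2 (not_lt.2 h'.1)
    -- To the right of `β` the primitive equals the full integral of `χ`, which vanishes.
    · have h := not_le.1 h
      simp only
      rw [intervalIntegral.integral_of_le (hαβ.trans h.le), ← h0, ← integral_Icc_eq_integral_Ioc]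
      refine setIntegral_eq_integral_of_forall_compl_eq_zero fun s hns => hzero s fun h' => hns ?_
      exact ⟨h'.1, h'.2.trans h.le⟩
  refine ⟨fun s => ∫ r in α..s, χ r, ?_, ?_, ?_, hderiv⟩
  · rw [contDiff_infty_iff_deriv, hderiv]
    exact ⟨fun x => (hder x).differentiableAt, hχ⟩
  · exact HasCompactSupport.of_support_subset_isCompact isCompact_Icc hsupp
  · refine (closure_minimal hsupp isClosed_Icc).trans fun x hx => ?_
    exact ⟨(hs hmin).1.trans_le hx.1, hx.2.trans_lt (hs hmax).2⟩

/-- **Du Bois-Reymond**: a function with vanishing weak derivative is almost everywhere constant. -/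
lemma IsWeakDeriv.exists_ae_eq_const [CompleteSpace E] (hab : a < b)
    (h : IsWeakDeriv 1 u (fun _ => 0) a b) : ∃ C, ∀ᵐ s, s ∈ Ioo a b → u s = C := by
  have hpos : 0 < (b - a) / 4 := by linarith
  let ψ₀ : ContDiffBump ((a + b) / 2) := ⟨(b - a) / 4, (b - a) / 3, hpos, by linarith⟩
  let ψ : ℝ → ℝ := ψ₀.normed volume
  have hψ : ContDiff ℝ ∞ ψ := ψ₀.contDiff_normed
  have hψc : HasCompactSupport ψ := ψ₀.hasCompactSupport_normed
  have hψs : tsupport ψ ⊆ Ioo a b := by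
    rw [ψ₀.tsupport_normed_eq, Real.closedBall_eq_Icc]
    intro x hx
    simp only [ψ₀, mem_Icc] at hx
    constructor <;> linarith [hx.1, hx.2]
  have hψ1 : ∫ s, ψ s = 1 := ψ₀.integral_normed
  -- The constant is the mean of `u` against the unit-mass bump `ψ`. For a test function `φ` of
  -- integral `m`, `φ - m ψ` is the derivative of a test function, so its pairing with `u` vanishes.
  refine ⟨∫ s in Ioo a b, ψ s • u s, ?_⟩
  set C := ∫ s in Ioo a b, ψ s • u s with hC
  have key := isOpen_Ioo.ae_eq_zero_of_integral_contDiff_smul_eq_zero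
    (μ := volume) (f := fun s => u s - C) (U := Ioo a b)
    (h.1.sub (continuous_const.locallyIntegrable.locallyIntegrableOn _)) ?_
  · filter_upwards [key] with s hs hs'
    exact sub_eq_zero.1 (hs hs')
  intro φ hφ hc hs
  have hiφ : Integrable φ := hφ.continuous.integrable_of_hasCompactSupport hc
  have hiψ : Integrable ψ := hψ.continuous.integrable_of_hasCompactSupport hψc
  set m := ∫ s, φ s with hm
  obtain ⟨η, hη, hηc, hηs, hηd⟩ := exists_primitive_test (a := a) (b := b)
    (χ := fun s => φ s - m * ψ s)
    (hφ.sub (contDiff_const.mul hψ)) (hc.sub (hψc.mul_left (f := fun _ => m)))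
    ((tsupport_sub _ _).trans (union_subset hs
      ((tsupport_mul_subset_right (f := fun _ => m)).trans hψs)))
    (by rw [integral_sub hiφ (hiψ.const_mul m), integral_const_mul, hψ1, ← hm]; ring)
  have e := h.2.2 η hη hηc hηs
  rw [iteratedDeriv_one, hηd] at e
  have i1 := integrableOn_smul_of_locallyIntegrableOn hφ.continuous hc hs h.1
  have i2 := integrableOn_smul_of_locallyIntegrableOn hψ.continuous hψc hψs h.1
  have e' : ∫ s in Ioo a b, φ s • u s = m • C := by
    have : ∫ s in Ioo a b, (φ s - m * ψ s) • u s
        = (∫ s in Ioo a b, φ s • u s) - m • C := by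
      rw [hC, ← integral_smul, ← integral_sub i1 (i2.integrable.fun_smul m)]
      simp only [sub_smul, mul_smul]
    rw [this] at e
    simpa [sub_eq_zero] using e
  rw [← setIntegral_eq_integral_of_tsupport_subset hs]
  simp_rw [smul_sub]
  rw [integral_sub i1 (integrableOn_smul_of_locallyIntegrableOn hφ.continuous hc hs
    (continuous_const.locallyIntegrable.locallyIntegrableOn _)), e',
    setIntegral_eq_integral_of_tsupport_subset hs, integral_smul_const, sub_self]

lemma IsWeakDeriv.sub (h₁ : IsWeakDeriv 1 u g₁ a b) (h₂ : IsWeakDeriv 1 v g₂ a b) :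
    IsWeakDeriv 1 (fun s => u s - v s) (fun s => g₁ s - g₂ s) a b := by
  refine ⟨h₁.1.sub h₂.1, h₁.2.1.sub h₂.2.1, fun φ hφ hc hs => ?_⟩
  have hφ' : Continuous (iteratedDeriv 1 φ) := by
    rw [iteratedDeriv_one]; exact (contDiff_infty_iff_deriv.1 hφ).2.continuous
  have hc' : HasCompactSupport (iteratedDeriv 1 φ) := by rw [iteratedDeriv_one]; exact hc.deriv
  have hs' : tsupport (iteratedDeriv 1 φ) ⊆ Ioo a b := by
    rw [iteratedDeriv_one]; exact (tsupport_deriv_subset (𝕜 := ℝ)).trans hs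
  simp_rw [smul_sub]
  rw [integral_sub (integrableOn_smul_of_locallyIntegrableOn hφ' hc' hs' h₁.1)
    (integrableOn_smul_of_locallyIntegrableOn hφ' hc' hs' h₂.1),
    integral_sub (integrableOn_smul_of_locallyIntegrableOn hφ.continuous hc hs h₁.2.1)
    (integrableOn_smul_of_locallyIntegrableOn hφ.continuous hc hs h₂.2.1),
    h₁.2.2 φ hφ hc hs, h₂.2.2 φ hφ hc hs, smul_sub]

end NormedSpace

/-- `u` is, on `[0, L]`, an indefinite integral of the integrable function `g`. -/
def IsPrimitive [NormedSpace ℝ E] (u g : ℝ → E) (L : ℝ) : Prop :=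
  IntervalIntegrable g volume 0 L ∧ ∀ s ∈ Icc 0 L, u s = u 0 + ∫ r in 0..s, g r

section Primitive

variable [NormedSpace ℝ E] {u v g : ℝ → E} {L : ℝ}

lemma IsPrimitive.intervalIntegrable (h : IsPrimitive u g L) {s t : ℝ} (hs : s ∈ Icc 0 L)
    (ht : t ∈ Icc 0 L) : IntervalIntegrable g volume s t := by
  refine h.1.mono_set ?_
  rw [uIcc_of_le (hs.1.trans hs.2)]
  exact uIcc_subset_Icc hs ht

lemma IsPrimitive.sub_eq (h : IsPrimitive u g L) {s t : ℝ} (hs : s ∈ Icc 0 L)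
    (ht : t ∈ Icc 0 L) : u t - u s = ∫ r in s..t, g r := by
  have h0 : (0 : ℝ) ∈ Icc 0 L := ⟨le_rfl, hs.1.trans hs.2⟩
  rw [h.2 s hs, h.2 t ht, add_sub_add_left_eq_sub]
  exact intervalIntegral.integral_interval_sub_left (h.intervalIntegrable h0 ht)
    (h.intervalIntegrable h0 hs)

lemma IsPrimitive.continuousOn (h : IsPrimitive u g L) (hL : 0 ≤ L) :
    ContinuousOn u (Icc 0 L) := by
  have := intervalIntegral.continuousOn_primitive_interval' h.1 (left_mem_uIcc)
  rw [uIcc_of_le hL] at this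
  exact (continuousOn_const (c := u 0).add this).congr fun s hs => h.2 s hs

end Primitive

section Inner

variable [InnerProductSpace ℝ E] [CompleteSpace E] {u v g : ℝ → E} {L : ℝ}

/-- Pairing with a fixed vector `x` reduces the claim to integration by parts for real absolutely
continuous functions. -/
lemma IsPrimitive.isWeakDeriv (h : IsPrimitive u g L) (hL : 0 < L) : IsWeakDeriv 1 u g 0 L := by
  have hgi : IntegrableOn g (Ioo 0 L) :=
    ((intervalIntegrable_iff_integrableOn_Ioc_of_le hL.le).1 h.1).mono_set Ioo_subset_Ioc_self
  have hui : IntegrableOn u (Ioo 0 L) :=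
    (h.continuousOn hL.le).integrableOn_Icc.mono_set Ioo_subset_Icc_self
  refine ⟨hui.locallyIntegrableOn, hgi.locallyIntegrableOn, fun φ hφ hc hs => ?_⟩
  rw [iteratedDeriv_one, pow_one, neg_one_smul]
  have hφ0 : φ 0 = 0 := image_eq_zero_of_notMem_tsupport fun h' => lt_irrefl _ (hs h').1
  have hφL : φ L = 0 := image_eq_zero_of_notMem_tsupport fun h' => lt_irrefl _ (hs h').2
  have hφ' : ContDiff ℝ ∞ (deriv φ) := (contDiff_infty_iff_deriv.1 hφ).2
  have i1 : IntegrableOn (fun s => deriv φ s • u s) (Ioo 0 L) :=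
    integrableOn_smul_of_locallyIntegrableOn hφ'.continuous hc.deriv
      ((tsupport_deriv_subset (𝕜 := ℝ)).trans hs) hui.locallyIntegrableOn
  have i2 : IntegrableOn (fun s => φ s • g s) (Ioo 0 L) :=
    integrableOn_smul_of_locallyIntegrableOn hφ.continuous hc hs hgi.locallyIntegrableOn
  refine ext_inner_left ℝ fun x => ?_
  rw [inner_neg_right, ← integral_inner i1, ← integral_inner i2]
  simp_rw [inner_smul_right]
  have hxi : IntervalIntegrable (fun r => inner ℝ x (g r)) volume 0 L :=
    ⟨h.1.1.const_inner x, h.1.2.const_inner x⟩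
  have hac : AbsolutelyContinuousOnInterval (fun s => ∫ r in 0..s, inner ℝ x (g r)) 0 L :=
    hxi.absolutelyContinuousOnInterval_intervalIntegral left_mem_uIcc
  have hacφ : AbsolutelyContinuousOnInterval φ 0 L :=
    (hφ.of_le (by exact_mod_cast le_top)).contDiffOn.absolutelyContinuousOnInterval
  have ibp := hacφ.integral_mul_deriv_eq_deriv_mul hac
  rw [hφ0, hφL] at ibp
  have hφi : ∫ s in 0..L, deriv φ s = 0 := by
    rw [hacφ.integral_deriv_eq_sub, hφ0, hφL, sub_zero]
  have e1 : ∫ s in Ioo 0 L, deriv φ s * inner ℝ x (u s)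
      = ∫ s in 0..L, deriv φ s * ∫ r in 0..s, inner ℝ x (g r) := by
    have : ∫ s in Ioo 0 L, deriv φ s * inner ℝ x (u s)
      = ∫ s in 0..L, (deriv φ s * inner ℝ x (u 0) + deriv φ s * ∫ r in 0..s, inner ℝ x (g r)) := by
      rw [intervalIntegral.integral_of_le hL.le, ← integral_Ioc_eq_integral_Ioo]
      refine setIntegral_congr_fun measurableSet_Ioc fun s hs => ?_
      have hs' : s ∈ Icc 0 L := Ioc_subset_Icc_self hs
      rw [h.2 s hs', inner_add_right, mul_add]
      congr 2
      exact ((innerSL ℝ x).intervalIntegral_comp_comm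
        (h.intervalIntegrable ⟨le_rfl, hL.le⟩ hs')).symm
    rw [this, intervalIntegral.integral_add, intervalIntegral.integral_mul_const, hφi, zero_mul,
      zero_add]
    · exact (hφ'.continuous.mul continuous_const).intervalIntegrable _ _
    · exact (hφ'.continuous.continuousOn.mul hac.continuousOn).intervalIntegrable
  have e2 : ∫ s in Ioo 0 L, φ s * inner ℝ x (g s)
      = ∫ s in 0..L, φ s * deriv (fun s => ∫ r in 0..s, inner ℝ x (g r)) s := by
    rw [intervalIntegral.integral_of_le hL.le, ← integral_Ioc_eq_integral_Ioo]
    refine setIntegral_congr_ae measurableSet_Ioc ?_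
    filter_upwards [hxi.ae_hasDerivAt_integral] with s h1 h2
    rw [(h1 (by rw [uIcc_of_le hL.le]; exact Ioc_subset_Icc_self h2) 0 left_mem_uIcc).deriv]
  rw [e1, e2, ibp]
  ring

/-- A function with an integrable weak derivative is almost everywhere an indefinite integral. -/
lemma IsWeakDeriv.exists_isPrimitive (hL : 0 < L) (h : IsWeakDeriv 1 u g 0 L)
    (hg : IntegrableOn g (Ioo 0 L)) :
    ∃ v, IsPrimitive v g L ∧ ∀ᵐ s, s ∈ Ioo 0 L → u s = v s := by
  have hgi : IntervalIntegrable g volume 0 L := by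
    rw [intervalIntegrable_iff_integrableOn_Ioc_of_le hL.le]
    exact (integrableOn_Ioc_iff_integrableOn_Ioo).2 hg
  have hp : IsPrimitive (fun s => ∫ r in 0..s, g r) g L := ⟨hgi, fun s _ => by simp⟩
  have hd := h.sub (hp.isWeakDeriv hL)
  simp only [sub_self] at hd
  obtain ⟨C, hC⟩ := hd.exists_ae_eq_const hL
  refine ⟨fun s => C + ∫ r in 0..s, g r, ⟨hgi, fun s _ => by simp⟩, ?_⟩
  filter_upwards [hC] with s h1 h2
  rw [← h1 h2, sub_add_cancel]

lemma eqOn_of_ae_eq {F : Type*} [TopologicalSpace F] [T2Space F] {u v : ℝ → F} {L : ℝ}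
    (hL : 0 < L) (hu : ContinuousOn u (Icc 0 L))
    (hv : ContinuousOn v (Icc 0 L)) (h : ∀ᵐ s, s ∈ Ioo 0 L → u s = v s) :
    EqOn u v (Icc 0 L) :=
  Measure.eqOn_Icc_of_ae_eq volume hL.ne
    ((ae_restrict_iff' measurableSet_Icc).2 (by
      have h2 : ∀ᵐ s : ℝ, s ≠ 0 ∧ s ≠ L := by
        filter_upwards [compl_mem_ae_iff.2 (measure_singleton (0 : ℝ)),
          compl_mem_ae_iff.2 (measure_singleton L)] with s h1 h2 using ⟨h1, h2⟩
      filter_upwards [h, h2] with s h1 h2 h3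
      exact h1 ⟨lt_of_le_of_ne h3.1 h2.1.symm, lt_of_le_of_ne h3.2 h2.2⟩)) hu hv

/-- A continuous function in `W^{2,p}` is a twofold indefinite integral. -/
lemma MemSobolev.exists_isPrimitive {p : ℝ≥0∞} (hp : 1 ≤ p) (hL : 0 < L)
    (hu : ContinuousOn u (Icc 0 L)) (h : MemSobolev 2 p u 0 L) :
    ∃ v g, IsPrimitive u v L ∧ IsPrimitive v g L ∧ MemLp g p (volume.restrict (Ioo 0 L)) := by
  obtain ⟨v, hv, -⟩ := h 1 (by norm_num)
  obtain ⟨g, hg, hgp⟩ := h 2 le_rfl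
  have hgi : IntegrableOn g (Ioo 0 L) := hgp.integrable hp
  -- The weak first derivative `v` has weak derivative `g`, so it has a continuous representative
  -- `w`, which may replace it as weak derivative of `u`.
  obtain ⟨w, hw, hvw⟩ := (hv.of_order_two hg).exists_isPrimitive hL hgi
  have hwi : IntegrableOn w (Ioo 0 L) :=
    (hw.continuousOn hL.le).integrableOn_Icc.mono_set Ioo_subset_Icc_self
  have hvw' : v =ᵐ[volume.restrict (Ioo 0 L)] w := (ae_restrict_iff' measurableSet_Ioo).2 hvw
  have huw : IsWeakDeriv 1 u w 0 L := by
    refine ⟨hv.1, hwi.locallyIntegrableOn, fun φ hφ hc hs => ?_⟩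
    rw [hv.2.2 φ hφ hc hs]
    congr 1
    refine integral_congr_ae ?_
    filter_upwards [hvw'] with s hs
    rw [hs]
  obtain ⟨u', hu', huu'⟩ := huw.exists_isPrimitive hL hwi
  have heq := eqOn_of_ae_eq hL hu (hu'.continuousOn hL.le) huu'
  refine ⟨w, g, ⟨hu'.1, fun s hs => ?_⟩, hw, hgp⟩
  rw [heq hs, heq ⟨le_rfl, hL.le⟩, hu'.2 s hs]

lemma IsPrimitive.memSobolev {p : ℝ≥0∞} (hL : 0 < L) (hu : IsPrimitive u v L)
    (hv : IsPrimitive v g L) (hg : MemLp g p (volume.restrict (Ioo 0 L))) :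
    MemSobolev 2 p u 0 L := by
  have hcont : ∀ {w : ℝ → E}, ContinuousOn w (Icc 0 L) → MemLp w p (volume.restrict (Ioo 0 L)) := by
    intro w hw
    obtain ⟨C, hC⟩ := isCompact_Icc.exists_bound_of_continuousOn hw
    refine MemLp.of_bound ((hw.mono Ioo_subset_Icc_self).aestronglyMeasurable measurableSet_Ioo) C ?_
    exact (ae_restrict_iff' measurableSet_Ioo).2
      (Eventually.of_forall fun s hs => hC s (Ioo_subset_Icc_self hs))
  have h1 := hu.isWeakDeriv hL
  have h2 := hv.isWeakDeriv hL
  intro j hj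
  interval_cases j
  · exact ⟨u, ⟨h1.1, h1.1, fun φ _ _ _ => by simp⟩, hcont (hu.continuousOn hL.le)⟩
  · exact ⟨v, h1, hcont (hv.continuousOn hL.le)⟩
  · exact ⟨g, h1.trans h2, hg⟩

end Inner

end WeakDerivatives

/-! ### The `p`-rotation as a sum over corners -/

section PRotation

lemma lintegral_Ioo_split {a b : ℝ} (ha : 0 ≤ a) (hb : 0 ≤ b) (f : ℝ → ℝ≥0∞) :
    ∫⁻ s in Ioo 0 (a + b), f s = (∫⁻ s in Ioo 0 a, f s) + ∫⁻ s in Ioo 0 b, f (s + a) := by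
  have h1 : ∫⁻ s in Ioo 0 b, f (s + a) = ∫⁻ s in Ioo a (a + b), f s := by
    have hpre : (fun s : ℝ => s + a) ⁻¹' Ioo a (a + b) = Ioo 0 b := by
      ext s; simp only [mem_preimage, mem_Ioo]; constructor <;> rintro ⟨h, h'⟩ <;>
        constructor <;> linarith
    rw [← hpre]
    exact (measurePreserving_add_right volume a).setLIntegral_comp_preimage_emb
      (Homeomorph.addRight a).measurableEmbedding f _
  rw [h1]
  simp_rw [restrict_Ioo_eq_restrict_Ioc]
  rw [← lintegral_union measurableSet_Ioc (Ioc_disjoint_Ioc_of_le le_rfl),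
    Ioc_union_Ioc_eq_Ioc ha (by linarith)]

variable {E : Type*} [NormedAddCommGroup E]

/-- A second derivative depends only on the germ of the curve, and the open intervals omit the
junctions. No matching of consecutive pieces is therefore required. -/
lemma lintegral_concat [NormedSpace ℝ E] (F : E → ℝ≥0∞) (l : List (Piece E))
    (hl : ∀ a ∈ l, 0 ≤ a.len) :
    ∫⁻ s in Ioo 0 (totalLength l), F (deriv (deriv (concat l)) s)
      = (l.map fun a => ∫⁻ s in Ioo 0 a.len, F (deriv (deriv a.path) s)).sum := by
  induction l with
  | nil => simp [totalLength]
  | cons a l ih =>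
    have ha : 0 ≤ a.len := hl a (by simp)
    have hl' : ∀ b ∈ l, 0 ≤ b.len := fun b hb => hl b (by simp [hb])
    have hT : 0 ≤ totalLength l := List.sum_nonneg (by simpa using hl')
    have hlen : totalLength (a :: l) = a.len + totalLength l := by simp [totalLength]
    rw [hlen, lintegral_Ioo_split ha hT, List.map_cons, List.sum_cons, ← ih hl']
    congr 1
    · refine setLIntegral_congr_fun measurableSet_Ioo fun s hs => ?_
      have : concat (a :: l) =ᶠ[𝓝 s] a.path := by
        filter_upwards [Iio_mem_nhds hs.2] with r hr
        simp [concat, (show r ≤ a.len from le_of_lt hr)]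
      simp only [this.deriv.deriv_eq]
    · refine setLIntegral_congr_fun measurableSet_Ioo fun s hs => ?_
      have : concat (a :: l) =ᶠ[𝓝 (s + a.len)] fun r => concat l (r - a.len) := by
        filter_upwards [Ioi_mem_nhds (show a.len < s + a.len by linarith [hs.1])] with r hr
        simp [concat, not_le.2 (mem_Ioi.1 hr)]
      simp only [this.deriv.deriv_eq]
      have h1 : deriv (fun r => concat l (r - a.len)) = fun r => deriv (concat l) (r - a.len) := by
        ext r; rw [deriv_comp_sub_const]
      rw [h1, deriv_comp_sub_const, add_sub_cancel_right]

lemma cornerSize_pos {v : ℕ → E} {i : ℕ} (h : edge v i ≠ 0) (h' : edge v (i + 1) ≠ 0) :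
    0 < cornerSize v i :=
  lt_min (norm_pos_iff.2 h) (norm_pos_iff.2 h')

variable [InnerProductSpace ℝ E] {v : ℕ → E} {i : ℕ} {p : ℝ}

lemma deriv_deriv_segmentPiece (x y : E) (s : ℝ) :
    deriv (deriv (segmentPiece x y).path) s = 0 := by
  have : deriv (segmentPiece x y).path = fun _ => (1 / dist x y) • (y - x) := by
    ext r
    exact ((((hasDerivAt_id r).div_const (dist x y)).smul_const (y - x)).const_add x).deriv
  rw [this]; simp

lemma lintegral_segmentPiece (hp : 0 < p) (x y : E) :
    ∫⁻ s in Ioo 0 (segmentPiece x y).len, ‖deriv (deriv (segmentPiece x y).path) s‖ₑ ^ p = 0 := by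
  simp_rw [deriv_deriv_segmentPiece]
  simp [hp]

lemma turningAngle_nonneg (v : ℕ → E) (i : ℕ) : 0 ≤ turningAngle v i :=
  InnerProductGeometry.angle_nonneg _ _

lemma turningAngle_le_pi (v : ℕ → E) (i : ℕ) : turningAngle v i ≤ Real.pi :=
  InnerProductGeometry.angle_le_pi _ _

lemma norm_edgeDir (h : edge v i ≠ 0) : ‖edgeDir v i‖ = 1 := norm_smul_inv_norm h

lemma norm_edge_smul_edgeDir (v : ℕ → E) (i : ℕ) : ‖edge v i‖ • edgeDir v i = edge v i := by
  by_cases h : edge v i = 0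
  · simp [edgeDir, h]
  · rw [edgeDir, smul_inv_smul₀ (norm_ne_zero_iff.2 h)]

lemma inner_edgeDir (h : edge v i ≠ 0) (h' : edge v (i + 1) ≠ 0) :
    inner ℝ (edgeDir v i) (edgeDir v (i + 1)) = Real.cos (turningAngle v i) := by
  rw [turningAngle, InnerProductGeometry.cos_angle, edgeDir, edgeDir, real_inner_smul_left,
    real_inner_smul_right]
  field_simp

lemma tan_half_turningAngle_nonneg (v : ℕ → E) (i : ℕ) : 0 ≤ Real.tan (turningAngle v i / 2) :=
  Real.tan_nonneg_of_nonneg_of_le_pi_div_two (by linarith [turningAngle_nonneg v i])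
    (by linarith [turningAngle_le_pi v i])

lemma arcRadius_nonneg (v : ℕ → E) (i : ℕ) : 0 ≤ arcRadius v i :=
  div_nonneg (div_nonneg (le_min (norm_nonneg _) (norm_nonneg _)) zero_le_two)
    (tan_half_turningAngle_nonneg v i)

lemma arcPiece_len_nonneg (v : ℕ → E) (i : ℕ) : 0 ≤ (arcPiece v i).len := by
  unfold arcPiece
  split_ifs
  · exact dist_nonneg
  · exact mul_nonneg (arcRadius_nonneg v i) (turningAngle_nonneg v i)

/-- The contribution of the `i`-th corner to the `p`-rotation. -/
noncomputable def cornerEnergy (p : ℝ) (v : ℕ → E) (i : ℕ) : ℝ :=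
  turningAngle v i * (2 * Real.tan (turningAngle v i / 2) / cornerSize v i) ^ (p - 1)

lemma cornerEnergy_nonneg (p : ℝ) (v : ℕ → E) (i : ℕ) : 0 ≤ cornerEnergy p v i :=
  mul_nonneg (turningAngle_nonneg v i) (Real.rpow_nonneg (div_nonneg
    (mul_nonneg zero_le_two (tan_half_turningAngle_nonneg v i))
    (le_min (norm_nonneg _) (norm_nonneg _))) _)

lemma norm_sq_arcNormal (h : edge v i ≠ 0) (h' : edge v (i + 1) ≠ 0)
    (hs : Real.sin (turningAngle v i) ≠ 0) : ‖arcNormal v i‖ ^ 2 = 1 := by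
  rw [arcNormal, norm_smul, mul_pow, norm_sub_sq_real, norm_smul, norm_edgeDir h, norm_edgeDir h',
    real_inner_smul_right, real_inner_comm, inner_edgeDir h h', norm_inv, Real.norm_eq_abs,
    Real.norm_eq_abs, inv_pow, sq_abs, mul_one, sq_abs]
  rw [inv_mul_eq_one₀ (pow_ne_zero 2 hs), Real.sin_sq]
  ring

lemma inner_edgeDir_arcNormal (h : edge v i ≠ 0) (h' : edge v (i + 1) ≠ 0) :
    inner ℝ (edgeDir v i) (arcNormal v i) = 0 := by
  rw [arcNormal, real_inner_smul_right, inner_sub_right, inner_edgeDir h h', real_inner_smul_right,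
    real_inner_self_eq_norm_sq, norm_edgeDir h]
  ring

lemma norm_deriv_deriv_circle {e f x : E} (he : ‖e‖ = 1) (hf : ‖f‖ ^ 2 = 1) (hef : inner ℝ e f = 0)
    {R : ℝ} (hR : 0 < R) (s : ℝ) :
    ‖deriv (deriv fun s => x + (R * Real.sin (s / R)) • e + (R * (1 - Real.cos (s / R))) • f) s‖
      = R⁻¹ := by
  have hd : ∀ s : ℝ, HasDerivAt (fun s : ℝ => s / R) (1 / R) s := fun s =>
    (hasDerivAt_id s).div_const R
  have h1 : deriv (fun s => x + (R * Real.sin (s / R)) • e + (R * (1 - Real.cos (s / R))) • f)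
      = fun s => Real.cos (s / R) • e + Real.sin (s / R) • f := by
    ext s
    have a1 := (((hd s).sin.const_mul R).smul_const e).const_add x
    have a2 := (((hd s).cos.const_sub 1).const_mul R).smul_const f
    convert! (a1.add a2).deriv using 2
    · congr 1; field_simp
    · congr 1; field_simp
  have h2 : deriv (fun s => Real.cos (s / R) • e + Real.sin (s / R) • f) s
      = R⁻¹ • (-Real.sin (s / R) • e + Real.cos (s / R) • f) := by
    rw [(((hd s).cos.smul_const e).fun_add ((hd s).sin.smul_const f)).deriv, smul_add, smul_smul,
      smul_smul]
    congr 2 <;> ring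
  rw [h1, h2, norm_smul, norm_inv, Real.norm_of_nonneg hR.le]
  have h3 : ‖-Real.sin (s / R) • e + Real.cos (s / R) • f‖ ^ 2 = 1 := by
    rw [norm_add_sq_real, norm_smul, norm_smul, real_inner_smul_left, real_inner_smul_right, hef,
      mul_pow, mul_pow, hf, he, norm_neg, Real.norm_eq_abs, Real.norm_eq_abs, sq_abs, sq_abs]
    linarith [Real.sin_sq_add_cos_sq (s / R)]
  rw [(pow_eq_one_iff_of_nonneg (norm_nonneg _) two_ne_zero).1 h3, mul_one]

/-- The curvature is the constant `R⁻¹` on a piece of length `R θ`, which gives `θ (R⁻¹) ^ (p - 1)`.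
A corner with `θ = 0` is a segment, and both sides vanish. -/
lemma lintegral_arcPiece (hp : 1 < p) (h : edge v i ≠ 0) (h' : edge v (i + 1) ≠ 0)
    (hπ : turningAngle v i ≠ Real.pi) :
    ∫⁻ s in Ioo 0 (arcPiece v i).len, ‖deriv (deriv (arcPiece v i).path) s‖ₑ ^ p
      = ENNReal.ofReal (cornerEnergy p v i) := by
  unfold arcPiece
  split_ifs with h0
  · rw [lintegral_segmentPiece (by linarith), cornerEnergy, h0, zero_mul, ENNReal.ofReal_zero]
  · have hθ : 0 < turningAngle v i := lt_of_le_of_ne (turningAngle_nonneg v i) (Ne.symm h0)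
    have hθ' : turningAngle v i < Real.pi := lt_of_le_of_ne (turningAngle_le_pi v i) hπ
    have hr := cornerSize_pos h h'
    have htan : 0 < Real.tan (turningAngle v i / 2) :=
      Real.tan_pos_of_pos_of_lt_pi_div_two (by linarith) (by linarith)
    have hR : 0 < arcRadius v i := div_pos (half_pos hr) htan
    have hn : ∀ s : ℝ, ‖deriv (deriv fun s => tMinus v i
        + (arcRadius v i * Real.sin (s / arcRadius v i)) • edgeDir v i
        + (arcRadius v i * (1 - Real.cos (s / arcRadius v i))) • arcNormal v i) s‖ₑ ^ p
        = ENNReal.ofReal ((arcRadius v i)⁻¹ ^ p) := by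
      intro s
      rw [← ofReal_norm, norm_deriv_deriv_circle (norm_edgeDir h)
        (norm_sq_arcNormal h h' (Real.sin_pos_of_pos_of_lt_pi hθ hθ').ne')
        (inner_edgeDir_arcNormal h h') hR,
        ENNReal.ofReal_rpow_of_nonneg (inv_nonneg.2 hR.le) (by linarith)]
    simp only [hn]
    rw [setLIntegral_const, Real.volume_Ioo, sub_zero,
      ← ENNReal.ofReal_mul (Real.rpow_nonneg (inv_nonneg.2 hR.le) _), cornerEnergy]
    congr 1
    have hRi : 2 * Real.tan (turningAngle v i / 2) / cornerSize v i = (arcRadius v i)⁻¹ := by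
      rw [arcRadius]; field_simp
    rw [hRi, Real.rpow_sub_one (inv_ne_zero hR.ne')]
    field_simp

lemma smoothingPieces_len_nonneg (v : ℕ → E) (n : ℕ) : ∀ a ∈ smoothingPieces v n, 0 ≤ a.len := by
  intro a ha
  obtain ⟨i, -, hi⟩ := List.mem_flatMap.1 ha
  cases i with
  | zero => rw [List.mem_singleton.1 hi]; exact arcPiece_len_nonneg v 0
  | succ j =>
    rcases List.mem_cons.1 hi with rfl | hi
    · exact dist_nonneg
    · rw [List.mem_singleton.1 hi]; exact arcPiece_len_nonneg v (j + 1)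

lemma sum_map_smoothingPieces (f : Piece E → ℝ≥0∞) (hf : ∀ x y, f (segmentPiece x y) = 0) (n : ℕ) :
    ((smoothingPieces v n).map f).sum = ∑ i ∈ Finset.range (n - 1), f (arcPiece v i) := by
  unfold smoothingPieces
  generalize n - 1 = m
  induction m with
  | zero => simp
  | succ m ih =>
    rw [List.range_succ, List.flatMap_append, List.map_append, List.sum_append, ih,
      Finset.sum_range_succ]
    congr 1
    cases m <;> simp [hf]

/-- The `p`-rotation is the sum of the contributions of the corners. -/
lemma pRotation_eq_sum (hp : 1 < p) {n : ℕ} (he : ∀ i < n, edge v i ≠ 0)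
    (hπ : ∀ i, i + 1 < n → turningAngle v i ≠ Real.pi) :
    pRotation p v n = ENNReal.ofReal (∑ i ∈ Finset.range (n - 1), cornerEnergy p v i) := by
  rw [pRotation, if_neg (by push Not; exact hπ),
    lintegral_concat (fun x => ‖x‖ₑ ^ p) _ (smoothingPieces_len_nonneg v n),
    sum_map_smoothingPieces _ (fun x y => lintegral_segmentPiece (by linarith) x y),
    ENNReal.ofReal_sum_of_nonneg fun i _ => cornerEnergy_nonneg p v i]
  refine Finset.sum_congr rfl fun i hi => ?_
  have hi' : i + 1 < n := by have := Finset.mem_range.1 hi; omega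
  exact lintegral_arcPiece hp (he i (by omega)) (he _ hi') (hπ i hi')

/-- This is the length of the chord of the unit circle that subtends the angle `θ`. -/
lemma norm_edgeDir_sub (h : edge v i ≠ 0) (h' : edge v (i + 1) ≠ 0) :
    ‖edgeDir v (i + 1) - edgeDir v i‖ = 2 * Real.sin (turningAngle v i / 2) := by
  have hs : 0 ≤ Real.sin (turningAngle v i / 2) :=
    Real.sin_nonneg_of_nonneg_of_le_pi (by linarith [turningAngle_nonneg v i])
      (by linarith [turningAngle_le_pi v i, Real.pi_pos])
  rw [← sq_eq_sq₀ (norm_nonneg _) (by positivity), norm_sub_sq_real, norm_edgeDir h,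
    norm_edgeDir h', real_inner_comm, inner_edgeDir h h', mul_pow, Real.sin_sq_eq_half_sub,
    mul_div_cancel₀ _ two_ne_zero]
  ring

end PRotation

/-! ### A Riesz-type criterion for `W^{1,p}` -/

section Riesz

/-- A monotone function carries disjoint intervals to disjoint intervals inside `[F a, F b]`; their
Lebesgue measures are then compared. -/
lemma sum_sub_le_of_disjWithin {F : ℝ → ℝ} {a b : ℝ} (hab : a ≤ b) (hF : MonotoneOn F (Icc a b))
    {I : ℕ × (ℕ → ℝ × ℝ)} (hI : I ∈ AbsolutelyContinuousOnInterval.disjWithin a b) :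
    ∑ i ∈ Finset.range I.1, |F (I.2 i).2 - F (I.2 i).1| ≤ F b - F a := by
  obtain ⟨h1, h2⟩ := hI
  rw [uIcc_of_le hab] at h1
  have hFab : F a ≤ F b := hF ⟨le_rfl, hab⟩ ⟨hab, le_rfl⟩ hab
  have hmin : ∀ {x y}, x ∈ Icc a b → y ∈ Icc a b → F (min x y) = min (F x) (F y) := by
    intro x y hx hy
    rcases le_total x y with h | h
    · rw [min_eq_left h, min_eq_left (hF hx hy h)]
    · rw [min_eq_right h, min_eq_right (hF hy hx h)]
  have hmax : ∀ {x y}, x ∈ Icc a b → y ∈ Icc a b → F (max x y) = max (F x) (F y) := by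
    intro x y hx hy
    rcases le_total x y with h | h
    · rw [max_eq_right h, max_eq_right (hF hx hy h)]
    · rw [max_eq_left h, max_eq_left (hF hy hx h)]
  have hdisj : Set.PairwiseDisjoint (Finset.range I.1 : Set ℕ)
      fun i => uIoc (F (I.2 i).1) (F (I.2 i).2) := by
    intro i hi j hj hij
    have hd := h2 hi hj hij
    obtain ⟨hi1, hi2⟩ := h1 i hi
    obtain ⟨hj1, hj2⟩ := h1 j hj
    simp only [Function.onFun, uIoc] at hd ⊢
    rw [Ioc_disjoint_Ioc] at hd ⊢
    rw [← hmin hi1 hi2, ← hmin hj1 hj2, ← hmax hi1 hi2, ← hmax hj1 hj2, ← hmin, ← hmax]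
    · refine hF ?_ ?_ hd <;> grind
    all_goals grind
  have hv : ∑ i ∈ Finset.range I.1, volume (uIoc (F (I.2 i).1) (F (I.2 i).2))
      ≤ volume (Icc (F a) (F b)) := by
    rw [← measure_biUnion_finset hdisj fun i _ => measurableSet_uIoc]
    refine measure_mono (iUnion₂_subset fun i hi => ?_)
    obtain ⟨hi1, hi2⟩ := h1 i hi
    have hm : ∀ x ∈ Icc a b, F x ∈ Icc (F a) (F b) := fun x hx =>
      ⟨hF ⟨le_rfl, hab⟩ hx hx.1, hF hx ⟨hab, le_rfl⟩ hx.2⟩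
    exact uIoc_subset_uIcc.trans (uIcc_subset_Icc (hm _ hi1) (hm _ hi2))
  simp only [Real.volume_Icc, Real.volume_uIoc] at hv
  rw [← ENNReal.ofReal_sum_of_nonneg fun i _ => abs_nonneg _,
    ENNReal.ofReal_le_ofReal_iff (by linarith)] at hv
  exact hv

variable {E : Type*} [NormedAddCommGroup E] {u : ℝ → E} {F : ℝ → ℝ} {p L : ℝ}

/-- `‖Δu‖ ^ p ≤ ΔF * Δ ^ (p - 1)` on all subintervals of `[0, L]`. -/
def DominatedIncrements (p : ℝ) (u : ℝ → E) (F : ℝ → ℝ) (L : ℝ) : Prop :=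
  MonotoneOn F (Icc 0 L) ∧ ∀ a ∈ Icc 0 L, ∀ b ∈ Icc 0 L, a ≤ b →
    ‖u b - u a‖ ^ p ≤ (F b - F a) * (b - a) ^ (p - 1)

/-- Either `x ≤ K d`, or `x ^ (p - 1) ≥ (K d) ^ (p - 1)` and the hypothesis gives `x K ^ (p - 1) ≤
y`. The product of `y` and `d` becomes a sum, which can be added up over disjoint intervals. -/
lemma le_add_div_of_rpow_le {x y d K : ℝ} (hp : 1 < p) (hy : 0 ≤ y) (hd : 0 ≤ d)
    (hK : 0 < K) (h : x ^ p ≤ y * d ^ (p - 1)) : x ≤ K * d + y / K ^ (p - 1) := by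
  have hKp : 0 < K ^ (p - 1) := Real.rpow_pos_of_pos hK _
  by_cases hxd : x ≤ K * d
  · have := div_nonneg hy hKp.le
    linarith
  push Not at hxd
  have hx0 : 0 < x := lt_of_le_of_lt (by positivity) hxd
  have h1 : x ^ p = x * x ^ (p - 1) := by
    rw [Real.rpow_sub_one hx0.ne']; field_simp
  have h2 : (K * d) ^ (p - 1) ≤ x ^ (p - 1) :=
    Real.rpow_le_rpow (by positivity) hxd.le (by linarith)
  rw [Real.mul_rpow hK.le hd] at h2
  have hxp : 0 < x ^ (p - 1) := Real.rpow_pos_of_pos hx0 _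
  have h3 : x * K ^ (p - 1) ≤ y := by
    refine le_of_mul_le_mul_right ?_ hxp
    calc x * K ^ (p - 1) * x ^ (p - 1) = K ^ (p - 1) * x ^ p := by rw [h1]; ring
      _ ≤ K ^ (p - 1) * (y * d ^ (p - 1)) := by gcongr
      _ = y * (K ^ (p - 1) * d ^ (p - 1)) := by ring
      _ ≤ y * x ^ (p - 1) := by gcongr
  have : x ≤ y / K ^ (p - 1) := (le_div_iff₀ hKp).2 h3
  have : 0 ≤ K * d := by positivity
  linarith

lemma DominatedIncrements.norm_sub_le (h : DominatedIncrements p u F L) (hp : 1 < p) {K : ℝ}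
    (hK : 0 < K) {a b : ℝ} (ha : a ∈ Icc 0 L) (hb : b ∈ Icc 0 L) :
    dist (u a) (u b) ≤ K * dist a b + |F b - F a| / K ^ (p - 1) := by
  wlog hab : a ≤ b generalizing a b
  · rw [dist_comm, dist_comm a, abs_sub_comm]
    exact this hb ha (le_of_not_ge hab)
  have hF : 0 ≤ F b - F a := sub_nonneg.2 (h.1 ha hb hab)
  rw [dist_comm, dist_eq_norm, Real.dist_eq, abs_sub_comm, abs_of_nonneg (sub_nonneg.2 hab),
    abs_of_nonneg hF]
  exact le_add_div_of_rpow_le hp hF (sub_nonneg.2 hab) hK (h.2 a ha b hb hab)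

lemma DominatedIncrements.absolutelyContinuousOnInterval (h : DominatedIncrements p u F L)
    (hp : 1 < p) (hL : 0 ≤ L) : AbsolutelyContinuousOnInterval u 0 L := by
  rw [absolutelyContinuousOnInterval_iff]
  intro ε hε
  -- `K` is chosen first, so that the total variation of `F` contributes less than `ε / 2`; the
  -- total length of the intervals is then taken below `ε / (2K)`.
  obtain ⟨K, hK, hKε⟩ : ∃ K : ℝ, 0 < K ∧ (F L - F 0) / K ^ (p - 1) < ε / 2 := by
    have ht : Tendsto (fun K : ℝ => (F L - F 0) / K ^ (p - 1)) atTop (𝓝 0) :=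
      (tendsto_rpow_atTop (by linarith)).const_div_atTop _
    exact ((eventually_gt_atTop 0).and (ht.eventually_lt_const (half_pos hε))).exists
  refine ⟨ε / 2 / K, by positivity, fun I hI hIδ => ?_⟩
  have hI1 := hI.1
  rw [uIcc_of_le hL] at hI1
  calc ∑ i ∈ Finset.range I.1, dist (u (I.2 i).1) (u (I.2 i).2)
      ≤ ∑ i ∈ Finset.range I.1, (K * dist (I.2 i).1 (I.2 i).2
        + |F (I.2 i).2 - F (I.2 i).1| / K ^ (p - 1)) :=
        Finset.sum_le_sum fun i hi => h.norm_sub_le hp hK (hI1 i hi).1 (hI1 i hi).2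
    _ = K * (∑ i ∈ Finset.range I.1, dist (I.2 i).1 (I.2 i).2)
        + (∑ i ∈ Finset.range I.1, |F (I.2 i).2 - F (I.2 i).1|) / K ^ (p - 1) := by
        rw [Finset.sum_add_distrib, Finset.mul_sum, Finset.sum_div]
    _ < K * (ε / 2 / K) + (F L - F 0) / K ^ (p - 1) := by
        refine add_lt_add_of_lt_of_le (mul_lt_mul_of_pos_left hIδ hK) ?_
        gcongr
        exact sum_sub_le_of_disjWithin hL h.1 hI
    _ < ε := by rw [mul_div_cancel₀ _ hK.ne']; linarith

/-- Dividing the increment bound on `[s, s + t]` by `t ^ p` leaves a difference quotient of `F` on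
the right. -/
lemma DominatedIncrements.norm_rpow_le [NormedSpace ℝ E] (h : DominatedIncrements p u F L)
    (hp : 1 < p) {s : ℝ} {x : E} {y : ℝ} (hs : s ∈ Ioo 0 L) (hu : HasDerivAt u x s)
    (hF : HasDerivAt F y s) : ‖x‖ ^ p ≤ y := by
  have h1 := (hasDerivAt_iff_tendsto_slope_zero.1 hu).mono_left (nhdsGT_le_nhdsNE 0)
  have h2 := (hasDerivAt_iff_tendsto_slope_zero.1 hF).mono_left (nhdsGT_le_nhdsNE 0)
  have h3 := h1.norm.rpow_const (p := p) (Or.inr (by linarith))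
  refine le_of_tendsto_of_tendsto h3 h2 ?_
  filter_upwards [Ioo_mem_nhdsGT (show (0 : ℝ) < L - s by linarith [hs.2])] with t ht
  have hb := h.2 s (Ioo_subset_Icc_self hs) (s + t)
    ⟨by linarith [hs.1, ht.1], by linarith [ht.2]⟩ (by linarith [ht.1])
  rw [add_sub_cancel_left] at hb
  rw [norm_smul, norm_inv, Real.norm_of_nonneg ht.1.le, smul_eq_mul,
    Real.mul_rpow (inv_nonneg.2 ht.1.le) (norm_nonneg _), Real.inv_rpow ht.1.le]
  have htp : 0 < t ^ p := Real.rpow_pos_of_pos ht.1 p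
  rw [inv_mul_le_iff₀ htp]
  refine hb.trans_eq ?_
  rw [Real.rpow_sub_one ht.1.ne']
  ring

/-- One implication of the **Riesz characterization** of `W^{1,p}`. -/
lemma DominatedIncrements.exists_isPrimitive [InnerProductSpace ℝ E] [FiniteDimensional ℝ E]
    (h : DominatedIncrements p u F L) (hp : 1 < p) (hL : 0 < L) :
    ∃ g : ℝ → E, IsPrimitive u g L ∧ MemLp g (ENNReal.ofReal p) (volume.restrict (Ioo 0 L)) ∧
      ∫⁻ s in Ioo 0 L, ‖g s‖ₑ ^ p ≤ ENNReal.ofReal (F L - F 0) := by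
  have hac := h.absolutelyContinuousOnInterval hp hL.le
  have hud : ∀ᵐ s, s ∈ uIcc 0 L → DifferentiableAt ℝ u s :=
    hac.boundedVariationOn.ae_differentiableAt_of_mem_uIcc
  have hFm : MonotoneOn F (uIcc 0 L) := by rw [uIcc_of_le hL.le]; exact h.1
  have hFd : ∀ᵐ s, s ∈ Icc 0 L → DifferentiableWithinAt ℝ F (Icc 0 L) s :=
    h.1.ae_differentiableWithinAt_of_mem
  have hle : ∀ᵐ s, s ∈ Ioo 0 L → ‖deriv u s‖ ^ p ≤ deriv F s := by
    filter_upwards [hud, hFd] with s h1 h2 hs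
    have hs' := Ioo_subset_Icc_self hs
    exact h.norm_rpow_le hp hs (h1 (by rwa [uIcc_of_le hL.le])).hasDerivAt
      ((h2 hs').differentiableAt (Icc_mem_nhds hs.1 hs.2)).hasDerivAt
  -- A monotone `F` need not be absolutely continuous, but `∫ F' ≤ F L - F 0` is the only direction
  -- used.
  have hint : ∫⁻ s in Ioo 0 L, ‖deriv u s‖ₑ ^ p ≤ ENNReal.ofReal (F L - F 0) := by
    have hF0 : F 0 ≤ F L := h.1 ⟨le_rfl, hL.le⟩ ⟨hL.le, le_rfl⟩ hL.le
    have hi := hFm.intervalIntegral_deriv_mem_uIcc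
    rw [uIcc_of_le (by linarith), intervalIntegral.integral_of_le hL.le,
      integral_Ioc_eq_integral_Ioo] at hi
    have hFi : IntegrableOn (deriv F) (Ioo 0 L) :=
      ((intervalIntegrable_iff_integrableOn_Ioc_of_le hL.le).1
        hFm.intervalIntegrable_deriv).mono_set Ioo_subset_Ioc_self
    have hle' := (ae_restrict_iff' (μ := volume) measurableSet_Ioo).2 hle
    refine le_trans (lintegral_mono_ae ?_) ((ofReal_integral_eq_lintegral_ofReal hFi
      (hle'.mono fun s hs => (Real.rpow_nonneg (norm_nonneg _) _).trans hs)).symm.le.trans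
        (ENNReal.ofReal_le_ofReal hi.2))
    filter_upwards [hle'] with s hs
    rw [← ofReal_norm, ENNReal.ofReal_rpow_of_nonneg (norm_nonneg _) (by linarith)]
    exact ENNReal.ofReal_le_ofReal hs
  have hmem : MemLp (deriv u) (ENNReal.ofReal p) (volume.restrict (Ioo 0 L)) := by
    refine ⟨(stronglyMeasurable_deriv u).aestronglyMeasurable, ?_⟩
    rw [eLpNorm_lt_top_iff_lintegral_rpow_enorm_lt_top
      (by simpa using (by linarith : 0 < p)) ENNReal.ofReal_ne_top,
      ENNReal.toReal_ofReal (by linarith)]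
    exact hint.trans_lt ENNReal.ofReal_lt_top
  have hgi : IntervalIntegrable (deriv u) volume 0 L := by
    rw [intervalIntegrable_iff_integrableOn_Ioc_of_le hL.le]
    exact (integrableOn_Ioc_iff_integrableOn_Ioo).2
      (hmem.integrable (by simpa using hp.le))
  refine ⟨deriv u, ⟨hgi, fun s hs => ?_⟩, hmem, hint⟩
  rw [← sub_eq_iff_eq_add']
  refine ext_inner_left ℝ fun x => ?_
  have hsub : uIcc 0 s ⊆ uIcc 0 L := by
    rw [uIcc_of_le hL.le]; exact uIcc_subset_Icc ⟨le_rfl, hL.le⟩ hs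
  have hxac : AbsolutelyContinuousOnInterval (fun r => inner ℝ x (u r)) 0 s := by
    have h0 : Tendsto _ _ _ := hac.mono hsub
    replace h0 := h0.const_mul ‖x‖
    rw [mul_zero] at h0
    refine squeeze_zero (fun t => Finset.sum_nonneg fun i hi => dist_nonneg) (fun t => ?_) h0
    rw [Finset.mul_sum]
    refine Finset.sum_le_sum fun i _ => ?_
    rw [Real.dist_eq, ← inner_sub_right, dist_eq_norm]
    exact abs_real_inner_le_norm _ _
  have e1 := hxac.integral_deriv_eq_sub
  have e2 : ∫ r in 0..s, inner ℝ x (deriv u r) = inner ℝ x (∫ r in 0..s, deriv u r) := by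
    simpa only [innerSL_apply_apply] using
      (innerSL ℝ x).intervalIntegral_comp_comm (hgi.mono_set hsub)
  rw [inner_sub_right, ← e1, ← e2]
  refine intervalIntegral.integral_congr_ae ?_
  filter_upwards [hud] with r hr hrs
  have hd := (hr (hsub (uIoc_subset_uIcc hrs))).hasDerivAt
  simpa using ((hasDerivAt_const r x).inner ℝ hd).deriv

end Riesz

/-! ### Hölder estimate along the edges of a polygonal -/

section DiscreteEstimates

variable {E : Type*} [NormedAddCommGroup E]

lemma sum_Ico_edge (v : ℕ → E) {i m : ℕ} (him : i ≤ m) :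
    ∑ k ∈ Finset.Ico i m, edge v k = v m - v i :=
  Finset.sum_Ico_sub v him

lemma cornerSize_nonneg (v : ℕ → E) (i : ℕ) : 0 ≤ cornerSize v i :=
  le_min (norm_nonneg _) (norm_nonneg _)

variable [InnerProductSpace ℝ E] {v : ℕ → E} {p : ℝ} {n i k m : ℕ}

/-- A lower bound for the contribution of the `i`-th corner to the `p`-rotation. -/
noncomputable def cornerBound (p : ℝ) (v : ℕ → E) (i : ℕ) : ℝ :=
  cornerSize v i * (turningAngle v i / cornerSize v i) ^ p

lemma cornerBound_nonneg (p : ℝ) (v : ℕ → E) (i : ℕ) : 0 ≤ cornerBound p v i :=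
  mul_nonneg (cornerSize_nonneg v i) (Real.rpow_nonneg
    (div_nonneg (turningAngle_nonneg v i) (cornerSize_nonneg v i)) _)

/-- This is `θ / 2 ≤ tan (θ / 2)`, applied in the factor with exponent `p - 1`. -/
lemma cornerBound_le_cornerEnergy (hp : 1 < p) (hπ : turningAngle v i ≠ Real.pi) :
    cornerBound p v i ≤ cornerEnergy p v i := by
  rcases (turningAngle_nonneg v i).eq_or_lt with h0 | h0
  · rw [cornerBound, cornerEnergy, ← h0, zero_div, Real.zero_rpow (by linarith)]
    simp
  rcases (cornerSize_nonneg v i).eq_or_lt with hr | hr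
  · rw [cornerBound, ← hr, zero_mul]
    exact cornerEnergy_nonneg p v i
  have hlt : turningAngle v i / 2 < Real.pi / 2 := by
    have := lt_of_le_of_ne (turningAngle_le_pi v i) hπ
    linarith
  have htan := Real.le_tan (half_pos h0).le hlt
  have h1 : cornerBound p v i
      = turningAngle v i * (turningAngle v i / cornerSize v i) ^ (p - 1) := by
    rw [cornerBound, Real.rpow_sub_one (div_pos h0 hr).ne']
    field_simp
  rw [h1, cornerEnergy]
  gcongr
  linarith

/-- Hölder estimate for the change of direction of the edges. -/
lemma norm_edgeDir_sub_rpow_le (hp : 1 < p) (he : ∀ k < n, edge v k ≠ 0) (him : i ≤ m)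
    (hm : m < n) :
    ‖edgeDir v m - edgeDir v i‖ ^ p ≤ (∑ k ∈ Finset.Ico i m, cornerBound p v k)
      * (∑ k ∈ Finset.Ico i m, ‖edge v k‖) ^ (p - 1) := by
  have hp0 : 0 < p := by linarith
  have hθ : ‖edgeDir v m - edgeDir v i‖ ≤ ∑ k ∈ Finset.Ico i m, turningAngle v k := by
    rw [← Finset.sum_Ico_sub (edgeDir v) him]
    refine (norm_sum_le _ _).trans (Finset.sum_le_sum fun k hk => ?_)
    have hk' := (Finset.mem_Ico.1 hk).2
    rw [norm_edgeDir_sub (he k (by omega)) (he (k + 1) (by omega))]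
    have := Real.sin_le (show 0 ≤ turningAngle v k / 2 by linarith [turningAngle_nonneg v k])
    linarith
  -- The weights are the corner sizes `r` and the function is `θ / r`, so the weighted sum is the
  -- total turning. At the end `r` is bounded by the length of the incoming edge.
  have hH := Real.inner_le_weight_mul_Lp_of_nonneg (Finset.Ico i m) hp.le (fun k => cornerSize v k)
    (fun k => turningAngle v k / cornerSize v k) (fun k => cornerSize_nonneg v k)
    (fun k => div_nonneg (turningAngle_nonneg v k) (cornerSize_nonneg v k))
  have hsum : ∑ k ∈ Finset.Ico i m, cornerSize v k * (turningAngle v k / cornerSize v k)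
      = ∑ k ∈ Finset.Ico i m, turningAngle v k := by
    refine Finset.sum_congr rfl fun k hk => ?_
    have hk' := (Finset.mem_Ico.1 hk).2
    rw [mul_div_cancel₀ _ (cornerSize_pos (he k (by omega)) (he (k + 1) (by omega))).ne']
  rw [hsum] at hH
  have hA : 0 ≤ ∑ k ∈ Finset.Ico i m, cornerBound p v k :=
    Finset.sum_nonneg fun k _ => cornerBound_nonneg p v k
  have hr : 0 ≤ ∑ k ∈ Finset.Ico i m, cornerSize v k :=
    Finset.sum_nonneg fun k _ => cornerSize_nonneg v k
  calc ‖edgeDir v m - edgeDir v i‖ ^ p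
      ≤ ((∑ k ∈ Finset.Ico i m, cornerSize v k) ^ (1 - p⁻¹)
        * (∑ k ∈ Finset.Ico i m, cornerBound p v k) ^ p⁻¹) ^ p :=
        Real.rpow_le_rpow (norm_nonneg _) (hθ.trans hH) hp0.le
    _ = (∑ k ∈ Finset.Ico i m, cornerBound p v k)
        * (∑ k ∈ Finset.Ico i m, cornerSize v k) ^ (p - 1) := by
        rw [Real.mul_rpow (Real.rpow_nonneg hr _) (Real.rpow_nonneg hA _), ← Real.rpow_mul hr,
          ← Real.rpow_mul hA, inv_mul_cancel₀ hp0.ne', Real.rpow_one, sub_mul,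
          inv_mul_cancel₀ hp0.ne', one_mul, mul_comm]
    _ ≤ _ := by
        gcongr with k hk
        exact min_le_left _ _

end DiscreteEstimates

/-! ### Locating a parameter on an inscribed polygonal -/

namespace InscribedPolygonal

variable {E : Type*} {c : ℝ → E} {L : ℝ} (P : InscribedPolygonal c L)

lemma n_pos (hL : 0 < L) : 0 < P.n := by
  by_contra h
  have h0 : P.n = 0 := by omega
  have := P.t_last
  rw [h0, P.t_zero] at this
  exact hL.ne this

lemma t_le_t {i j : ℕ} (hij : i ≤ j) (hj : j ≤ P.n) : P.t i ≤ P.t j := by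
  induction j, hij using Nat.le_induction with
  | base => exact le_rfl
  | succ j _ ih => exact (ih (by omega)).trans (P.t_lt j (by omega)).le

lemma t_mem {i : ℕ} (hi : i ≤ P.n) : P.t i ∈ Icc 0 L := by
  constructor
  · rw [← P.t_zero]; exact P.t_le_t (Nat.zero_le i) hi
  · exact (P.t_le_t hi le_rfl).trans_eq P.t_last

/-- The number of an edge whose parameter interval contains `s`. -/
noncomputable def index (s : ℝ) : ℕ := by
  -- The search stops at `P.n - 1`, so that `s = L` is assigned to the last edge.
  classical exact Nat.findGreatest (fun k => P.t k ≤ s) (P.n - 1)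

lemma index_lt (hL : 0 < L) (s : ℝ) : P.index s < P.n := by
  have h : P.index s ≤ P.n - 1 := Nat.findGreatest_le _
  have := P.n_pos hL
  omega

lemma t_index_le {s : ℝ} (hs : 0 ≤ s) : P.t (P.index s) ≤ s := by
  classical
  refine Nat.findGreatest_spec (P := fun k => P.t k ≤ s) (Nat.zero_le (P.n - 1)) ?_
  rw [P.t_zero]; exact hs

lemma le_t_index_add_one (hL : 0 < L) {s : ℝ} (hs : s ≤ L) : s ≤ P.t (P.index s + 1) := by
  classical
  rcases (Nat.succ_le_of_lt (P.index_lt hL s)).eq_or_lt with h | h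
  · rw [← Nat.succ_eq_add_one, h, P.t_last]; exact hs
  · exact le_of_not_ge (Nat.findGreatest_is_greatest (P := fun k => P.t k ≤ s)
      (n := P.n - 1) (Nat.lt_succ_self _) (by omega))

lemma index_mono {a b : ℝ} (hab : a ≤ b) : P.index a ≤ P.index b :=
  Nat.findGreatest_mono_left (fun _ h => le_trans h hab) _

variable [NormedAddCommGroup E] {c : ℝ → E} {L : ℝ} (P : InscribedPolygonal c L)

lemma edge_ne_zero {k : ℕ} (hk : k < P.n) : edge P.vertex k ≠ 0 :=
  sub_ne_zero.2 (P.nondegenerate k hk).symm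

/-- The difference between the length of the curve and the length of the polygonal. -/
noncomputable def slack : ℝ := L - ∑ k ∈ Finset.range P.n, ‖edge P.vertex k‖

end InscribedPolygonal

/-! ### Chords and edge directions of one inscribed polygonal -/

section SinglePolygonal

variable {E : Type*} [NormedAddCommGroup E] {c : ℝ → E} {L : ℝ}

lemma dist_le_of_hasUnitSpeedOn (hc : HasUnitSpeedOn c (Icc 0 L)) {a b : ℝ} (ha : a ∈ Icc 0 L)
    (hb : b ∈ Icc 0 L) (hab : a ≤ b) : ‖c b - c a‖ ≤ b - a := by
  have h1 : eVariationOn c (Icc 0 L ∩ Icc a b) = ENNReal.ofReal (b - a) := by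
    simpa using hc ha hb
  have h2 := eVariationOn.edist_le c (s := Icc 0 L ∩ Icc a b) (x := b) (y := a)
    ⟨hb, hab, le_rfl⟩ ⟨ha, le_rfl, hab⟩
  rw [h1, edist_dist, dist_eq_norm, ENNReal.ofReal_le_ofReal_iff (sub_nonneg.2 hab)] at h2
  exact h2

lemma lipschitzOnWith_of_hasUnitSpeedOn (hc : HasUnitSpeedOn c (Icc 0 L)) :
    LipschitzOnWith 1 c (Icc 0 L) := by
  refine LipschitzOnWith.of_dist_le_mul fun x hx y hy => ?_
  wlog h : y ≤ x generalizing x y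
  · rw [dist_comm, dist_comm x]
    exact this y hy x hx (le_of_not_ge h)
  rw [dist_eq_norm, Real.dist_eq, abs_of_nonneg (sub_nonneg.2 h)]
  simpa using dist_le_of_hasUnitSpeedOn hc hy hx h

variable (P : InscribedPolygonal c L) (hc : HasUnitSpeedOn c (Icc 0 L))
include hc

namespace InscribedPolygonal

lemma norm_edge_le {k : ℕ} (hk : k < P.n) : ‖edge P.vertex k‖ ≤ P.t (k + 1) - P.t k :=
  dist_le_of_hasUnitSpeedOn hc (P.t_mem hk.le) (P.t_mem hk) (P.t_lt k hk).le

lemma sub_sum_norm_edge_le_slack {s : Finset ℕ} (hs : s ⊆ Finset.range P.n) :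
    ∑ k ∈ s, (P.t (k + 1) - P.t k - ‖edge P.vertex k‖) ≤ P.slack := by
  have h : P.slack = ∑ k ∈ Finset.range P.n, (P.t (k + 1) - P.t k - ‖edge P.vertex k‖) := by
    rw [Finset.sum_sub_distrib, Finset.sum_range_sub, P.t_zero, P.t_last, sub_zero, slack]
  rw [h]
  exact Finset.sum_le_sum_of_subset_of_nonneg hs fun k hk _ =>
    sub_nonneg.2 (P.norm_edge_le hc (Finset.mem_range.1 hk))

lemma sum_Ico_norm_edge_le {i m : ℕ} (him : i ≤ m) (hm : m ≤ P.n) :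
    ∑ k ∈ Finset.Ico i m, ‖edge P.vertex k‖ ≤ P.t m - P.t i := by
  rw [← Finset.sum_Ico_sub P.t him]
  exact Finset.sum_le_sum fun k hk => P.norm_edge_le hc ((Finset.mem_Ico.1 hk).2.trans_le hm)

lemma le_sum_Ico_norm_edge {i m : ℕ} (him : i ≤ m) (hm : m ≤ P.n) :
    P.t m - P.t i - P.slack ≤ ∑ k ∈ Finset.Ico i m, ‖edge P.vertex k‖ := by
  have h := P.sub_sum_norm_edge_le_slack hc (s := Finset.Ico i m) fun k hk =>
    Finset.mem_range.2 ((Finset.mem_Ico.1 hk).2.trans_le hm)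
  rw [Finset.sum_sub_distrib, Finset.sum_Ico_sub P.t him] at h
  linarith

/-- The modulus controls chords, whereas the estimates need parameter intervals. Each such interval
exceeds its chord by at most the total excess, which is `slack`. -/
lemma mesh_le {k : ℕ} (hk : k < P.n) {η : ℝ} (hη : 0 ≤ η) (hP : P.modulus ≤ ENNReal.ofReal η) :
    P.t (k + 1) - P.t k ≤ P.slack + η := by
  have h1 := P.sub_sum_norm_edge_le_slack hc (s := {k}) (by simpa using hk)
  rw [Finset.sum_singleton] at h1
  have h2 : ‖edge P.vertex k‖ ≤ η := by
    have hle := (P.t_lt k hk).le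
    have h3 : Metric.ediam (c '' Icc (P.t k) (P.t (k + 1))) ≤ P.modulus :=
      le_iSup₂ (f := fun i (_ : i ∈ Finset.range P.n) =>
        Metric.ediam (c '' Icc (P.t i) (P.t (i + 1)))) k (Finset.mem_range.2 hk)
    have h4 := (Metric.edist_le_ediam_of_mem (mem_image_of_mem c (right_mem_Icc.2 hle))
      (mem_image_of_mem c (left_mem_Icc.2 hle))).trans (h3.trans hP)
    rw [edist_dist, dist_eq_norm, ENNReal.ofReal_le_ofReal_iff hη] at h4
    exact h4
  linarith

variable [InnerProductSpace ℝ E] {p M δ : ℝ} (hL : 0 < L) (hp : 1 < p)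
  (hδ : ∀ k < P.n, P.t (k + 1) - P.t k ≤ δ)

include hL hp hδ in
lemma norm_edgeDir_index_sub_rpow_le {a b : ℝ} (ha : a ∈ Icc 0 L) (hb : b ∈ Icc 0 L)
    {i m : ℕ} (hi : P.index a ≤ i) (him : i ≤ m) (hm : m ≤ P.index b) :
    ‖edgeDir P.vertex m - edgeDir P.vertex i‖ ^ p
      ≤ (∑ k ∈ Finset.Ico i m, cornerBound p P.vertex k) * (b - a + δ) ^ (p - 1) := by
  have hbn := P.index_lt hL b
  refine (norm_edgeDir_sub_rpow_le hp (fun k hk => P.edge_ne_zero hk) him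
    (hm.trans_lt hbn)).trans ?_
  have h1 := P.sum_Ico_norm_edge_le hc him (hm.trans hbn.le)
  have h2 := P.t_le_t hm hbn.le
  have h3 := P.t_le_t hi (him.trans (hm.trans hbn.le))
  have h4 := P.t_index_le hb.1
  have h5 := P.le_t_index_add_one hL ha.2
  have h6 := hδ _ (P.index_lt hL a)
  gcongr
  · exact Finset.sum_nonneg fun k _ => cornerBound_nonneg p _ k
  linarith

include hL hp hδ in
-- Up to two end pieces of size at most `δ`, the chord `c b - c a` is the sum of the edges in
-- between. Their directions differ from the one at `s` by at most the Hölder bound, and their total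
-- length differs from `b - a` by at most `2 * δ`.
lemma norm_sub_sub_smul_edgeDir_le (hM : ∑ k ∈ Finset.range (P.n - 1), cornerBound p P.vertex k ≤ M)
    (hs : P.slack ≤ δ) {a b s : ℝ} (ha : a ∈ Icc 0 L) (hb : b ∈ Icc 0 L)
    (has : a ≤ s) (hsb : s ≤ b) :
    ‖c b - c a - (b - a) • edgeDir P.vertex (P.index s)‖
      ≤ 4 * δ + (b - a + δ) * (M * (b - a + δ) ^ (p - 1)) ^ p⁻¹ := by
  have hab := has.trans hsb
  have hp0 : 0 < p := by linarith
  have hM0 : 0 ≤ M := (Finset.sum_nonneg fun k _ => cornerBound_nonneg p _ k).trans hM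
  set i := P.index a
  set m := P.index b
  set q := P.index s
  have hiq : i ≤ q := P.index_mono has
  have hqm : q ≤ m := P.index_mono hsb
  have hmn : m < P.n := P.index_lt hL b
  have hin : i < P.n := P.index_lt hL a
  have ta1 : P.t i ≤ a := P.t_index_le ha.1
  have ta2 : a ≤ P.t (i + 1) := P.le_t_index_add_one hL ha.2
  have ta3 := hδ i hin
  have tb1 : P.t m ≤ b := P.t_index_le hb.1
  have tb2 : b ≤ P.t (m + 1) := P.le_t_index_add_one hL hb.2
  have tb3 := hδ m hmn
  have hδ0 : 0 < δ := lt_of_lt_of_le (sub_pos.2 (P.t_lt m hmn)) tb3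
  set B := (M * (b - a + δ) ^ (p - 1)) ^ p⁻¹
  have hX : 0 ≤ M * (b - a + δ) ^ (p - 1) :=
    mul_nonneg hM0 (Real.rpow_nonneg (by linarith) _)
  have hB0 : 0 ≤ B := Real.rpow_nonneg hX _
  have hB : ∀ k l, i ≤ k → k ≤ l → l ≤ m → ‖edgeDir P.vertex l - edgeDir P.vertex k‖ ≤ B := by
    intro k l h1 h2 h3
    refine (Real.rpow_le_rpow_iff (norm_nonneg _) hB0 hp0).1 ?_
    rw [Real.rpow_inv_rpow hX hp0.ne']
    refine (P.norm_edgeDir_index_sub_rpow_le hc hL hp hδ ha hb h1 h2 h3).trans ?_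
    refine mul_le_mul_of_nonneg_right (le_trans ?_ hM) (Real.rpow_nonneg (by linarith) _)
    refine Finset.sum_le_sum_of_subset_of_nonneg (fun x hx => ?_)
      fun x _ _ => cornerBound_nonneg p _ x
    have := (Finset.mem_Ico.1 hx).2
    exact Finset.mem_range.2 (by omega)
  set S := ∑ k ∈ Finset.Ico i m, ‖edge P.vertex k‖
  have hS1 : S ≤ P.t m - P.t i := P.sum_Ico_norm_edge_le hc (hiq.trans hqm) hmn.le
  have hS2 : P.t m - P.t i - P.slack ≤ S := P.le_sum_Ico_norm_edge hc (hiq.trans hqm) hmn.le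
  have hS0 : 0 ≤ S := Finset.sum_nonneg fun k _ => norm_nonneg _
  have hsplit : c b - c a - (b - a) • edgeDir P.vertex q
      = (c b - c (P.t m)) - (c a - c (P.t i))
        + ∑ k ∈ Finset.Ico i m, ‖edge P.vertex k‖ • (edgeDir P.vertex k - edgeDir P.vertex q)
        + (S - (b - a)) • edgeDir P.vertex q := by
    have h1 : ∑ k ∈ Finset.Ico i m, ‖edge P.vertex k‖ • (edgeDir P.vertex k - edgeDir P.vertex q)
        = c (P.t m) - c (P.t i) - S • edgeDir P.vertex q := by
      simp_rw [smul_sub, norm_edge_smul_edgeDir]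
      rw [Finset.sum_sub_distrib, sum_Ico_edge _ (hiq.trans hqm), ← Finset.sum_smul]
      rfl
    rw [h1]
    module
  have n1 : ‖c b - c (P.t m)‖ ≤ δ :=
    (dist_le_of_hasUnitSpeedOn hc (P.t_mem hmn.le) hb tb1).trans (by linarith)
  have n2 : ‖c a - c (P.t i)‖ ≤ δ :=
    (dist_le_of_hasUnitSpeedOn hc (P.t_mem hin.le) ha ta1).trans (by linarith)
  have n3 : ‖∑ k ∈ Finset.Ico i m, ‖edge P.vertex k‖ •
      (edgeDir P.vertex k - edgeDir P.vertex q)‖ ≤ (b - a + δ) * B := by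
    refine (norm_sum_le _ _).trans ?_
    have : ∑ k ∈ Finset.Ico i m, ‖‖edge P.vertex k‖ •
        (edgeDir P.vertex k - edgeDir P.vertex q)‖ ≤ S * B := by
      rw [Finset.sum_mul]
      refine Finset.sum_le_sum fun k hk => ?_
      rw [norm_smul, norm_norm]
      refine mul_le_mul_of_nonneg_left ?_ (norm_nonneg _)
      obtain ⟨hk1, hk2⟩ := Finset.mem_Ico.1 hk
      rcases le_total k q with h | h
      · rw [norm_sub_rev]; exact hB k q hk1 h hqm
      · exact hB q k hiq h hk2.le
    exact this.trans (mul_le_mul_of_nonneg_right (by linarith) hB0)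
  have n4 : ‖(S - (b - a)) • edgeDir P.vertex q‖ ≤ 2 * δ := by
    rw [norm_smul, norm_edgeDir (P.edge_ne_zero (hqm.trans_lt hmn)), mul_one, Real.norm_eq_abs,
      abs_le]
    constructor <;> linarith
  rw [hsplit]
  have := norm_add₃_le (a := (c b - c (P.t m)) - (c a - c (P.t i)))
    (b := ∑ k ∈ Finset.Ico i m, ‖edge P.vertex k‖ • (edgeDir P.vertex k - edgeDir P.vertex q))
    (c := (S - (b - a)) • edgeDir P.vertex q)
  have n5 := norm_sub_le (c b - c (P.t m)) (c a - c (P.t i))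
  linarith

end InscribedPolygonal

end SinglePolygonal

/-! ### Lower bound: compactness of edge directions -/

section LowerBound

variable {E : Type*} [NormedAddCommGroup E] {c : ℝ → E} {L : ℝ}

lemma InscribedPolygonal.edist_index_le (P : InscribedPolygonal c L) (hL : 0 < L) {s : ℝ}
    (hs : s ∈ Icc 0 L) : edist (c (P.t (P.index s))) (c s) ≤ P.modulus := by
  have h1 : P.t (P.index s) ≤ s := P.t_index_le hs.1
  have h2 := P.le_t_index_add_one hL hs.2
  refine (Metric.edist_le_ediam_of_mem (mem_image_of_mem c (left_mem_Icc.2 (h1.trans h2)))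
    (mem_image_of_mem c ⟨h1, h2⟩)).trans ?_
  exact le_iSup₂ (f := fun i (_ : i ∈ Finset.range P.n) =>
    Metric.ediam (c '' Icc (P.t i) (P.t (i + 1)))) (P.index s)
    (Finset.mem_range.2 (P.index_lt hL s))

/-- The step function visits the vertices in order, so its jumps are bounded by telescoping partial
sums of edge lengths. It approximates `c` pointwise, which makes lower semicontinuity of the
variation applicable. -/
lemma InscribedPolygonal.eVariationOn_index_le (P : InscribedPolygonal c L) (hL : 0 < L) :
    eVariationOn (fun s => c (P.t (P.index s))) (Icc 0 L)
      ≤ ENNReal.ofReal (∑ k ∈ Finset.range P.n, ‖edge P.vertex k‖) := by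
  set S : ℕ → ℝ := fun m => ∑ k ∈ Finset.range m, ‖edge P.vertex k‖
  have hS : Monotone S := fun i j hij =>
    Finset.sum_le_sum_of_subset_of_nonneg (Finset.range_mono hij) fun k _ _ => norm_nonneg _
  have hd : ∀ {i j : ℕ}, i ≤ j → edist (c (P.t j)) (c (P.t i)) ≤ ENNReal.ofReal (S j - S i) := by
    intro i j hij
    rw [edist_dist, dist_eq_norm]
    refine ENNReal.ofReal_le_ofReal ?_
    have h1 := sum_Ico_edge P.vertex hij
    rw [← Finset.sum_Ico_eq_sub _ hij]
    exact (congrArg norm h1).symm.le.trans (norm_sum_le _ _)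
  refine iSup_le fun ⟨m, x, hx, _⟩ => ?_
  calc ∑ i ∈ Finset.range m, edist (c (P.t (P.index (x (i + 1))))) (c (P.t (P.index (x i))))
      ≤ ∑ i ∈ Finset.range m, ENNReal.ofReal (S (P.index (x (i + 1))) - S (P.index (x i))) :=
        Finset.sum_le_sum fun i _ => hd (P.index_mono (hx (Nat.le_succ i)))
    _ = ENNReal.ofReal (S (P.index (x m)) - S (P.index (x 0))) := by
        rw [← ENNReal.ofReal_sum_of_nonneg fun i _ =>
          sub_nonneg.2 (hS (P.index_mono (hx (Nat.le_succ i)))),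
          Finset.sum_range_sub (fun i => S (P.index (x i)))]
    _ ≤ ENNReal.ofReal (S P.n) := by
        refine ENNReal.ofReal_le_ofReal ?_
        have h1 : 0 ≤ S (P.index (x 0)) := Finset.sum_nonneg fun k _ => norm_nonneg _
        have h2 := hS (P.index_lt hL (x m)).le
        linarith

lemma InscribedPolygonal.slack_nonneg (P : InscribedPolygonal c L)
    (hc : HasUnitSpeedOn c (Icc 0 L)) : 0 ≤ P.slack := by
  simpa using P.sub_sum_norm_edge_le_slack hc (Finset.empty_subset _)

/-- The lengths of inscribed polygonals converge to the length of the curve. -/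
lemma tendsto_slack (hL : 0 < L) (hc : HasUnitSpeedOn c (Icc 0 L))
    {P : ℕ → InscribedPolygonal c L} (hP : Tendsto (fun h => (P h).modulus) atTop (𝓝 0)) :
    Tendsto (fun h => (P h).slack) atTop (𝓝 0) := by
  have hvar : eVariationOn c (Icc 0 L) = ENNReal.ofReal L := by
    simpa using hc (left_mem_Icc.2 hL.le) (right_mem_Icc.2 hL.le)
  have hconv : ∀ s ∈ Icc 0 L, Tendsto (fun h => c ((P h).t ((P h).index s))) atTop (𝓝 (c s)) :=
    fun s hs => tendsto_iff_edist_tendsto_0.2 (tendsto_of_tendsto_of_tendsto_of_le_of_le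
      tendsto_const_nhds hP (fun _ => zero_le) fun h => (P h).edist_index_le hL hs)
  refine tendsto_order.2 ⟨fun a ha => Eventually.of_forall fun h =>
    ha.trans_le ((P h).slack_nonneg hc), fun ε hε => ?_⟩
  have hv : ENNReal.ofReal (L - ε) < eVariationOn c (Icc 0 L) := by
    rw [hvar, ENNReal.ofReal_lt_ofReal_iff hL]
    linarith
  filter_upwards [eVariationOn.lowerSemicontinuous_aux hconv hv] with h hh
  have := (ENNReal.ofReal_lt_ofReal_iff').1 (hh.trans_le ((P h).eVariationOn_index_le hL))
  rw [InscribedPolygonal.slack]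
  linarith [this.1]

/-- A single ultrafilter gives convergence at all parameters simultaneously, in place of a Helly
selection argument. -/
lemma exists_tendsto_of_forall_mem {X : Type*} [TopologicalSpace X] {K : Set X} (hK : IsCompact K)
    (f : Ultrafilter ℕ) {x : ℕ → X} (hx : ∀ h, x h ∈ K) : ∃ y ∈ K, Tendsto x f (𝓝 y) := by
  obtain ⟨y, hy, h⟩ := hK.ultrafilter_le_nhds (f.map x)
    (le_principal_iff.2 (Eventually.of_forall hx : ∀ᶠ h in (f : Filter ℕ), x h ∈ K))
  exact ⟨y, hy, h⟩

variable [InnerProductSpace ℝ E] [FiniteDimensional ℝ E] {p M : ℝ}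

/-- The directions of the edges of polygonals of bounded `p`-rotation converge to a tangent. -/
lemma exists_tangent (hL : 0 < L) (hp : 1 < p) (hc : HasUnitSpeedOn c (Icc 0 L))
    {P : ℕ → InscribedPolygonal c L} (hP : Tendsto (fun h => (P h).modulus) atTop (𝓝 0))
    (hM : ∀ h, ∑ k ∈ Finset.range ((P h).n - 1), cornerBound p (P h).vertex k ≤ M) :
    ∃ (u : ℝ → E) (F : ℝ → ℝ), DominatedIncrements p u F L ∧ F L - F 0 ≤ M ∧
      ∀ a ∈ Icc 0 L, ∀ b ∈ Icc 0 L, ∀ s, a ≤ s → s ≤ b →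
        ‖c b - c a - (b - a) • u s‖ ≤ (b - a) * (M * (b - a) ^ (p - 1)) ^ p⁻¹ := by
  have hp0 : 0 < p := by linarith
  let f : Ultrafilter ℕ := hyperfilter ℕ
  have hf : (f : Filter ℕ) ≤ atTop := Nat.hyperfilter_le_atTop
  set τ : ℕ → ℝ → E := fun h s => edgeDir (P h).vertex ((P h).index s) with hτ
  set F : ℕ → ℝ → ℝ := fun h s => ∑ k ∈ Finset.range ((P h).index s),
    cornerBound p (P h).vertex k with hF
  -- This quantity bounds both the slack and, once the modulus is finite, the mesh.
  set δ : ℕ → ℝ := fun h => (P h).slack + ((P h).modulus).toReal with hδdef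
  have hδ : Tendsto δ f (𝓝 0) := by
    have h2 : Tendsto (fun h => ((P h).modulus).toReal) atTop (𝓝 0) := by
      simpa [Function.comp_def] using (ENNReal.tendsto_toReal ENNReal.zero_ne_top).comp hP
    simpa using ((tendsto_slack hL hc hP).add h2).mono_left hf
  have hmesh : ∀ᶠ h in (f : Filter ℕ), ∀ k < (P h).n, (P h).t (k + 1) - (P h).t k ≤ δ h := by
    filter_upwards [hf (hP.eventually_lt_const ENNReal.zero_lt_top)] with h hh k hk
    exact (P h).mesh_le hc hk ENNReal.toReal_nonneg (ENNReal.ofReal_toReal hh.ne).symm.le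
  have hFm : ∀ h, Monotone (F h) := fun h a b hab =>
    Finset.sum_le_sum_of_subset_of_nonneg (Finset.range_mono ((P h).index_mono hab))
      fun k _ _ => cornerBound_nonneg p _ k
  have hF0 : ∀ h s, 0 ≤ F h s := fun h s => Finset.sum_nonneg fun k _ => cornerBound_nonneg p _ k
  have hFM : ∀ h s, F h s ≤ M := fun h s => by
    refine le_trans (Finset.sum_le_sum_of_subset_of_nonneg (Finset.range_mono ?_)
      fun k _ _ => cornerBound_nonneg p _ k) (hM h)
    have := (P h).index_lt hL s
    omega
  choose u hu1 hu using fun s => exists_tendsto_of_forall_mem (isCompact_closedBall (0 : E) 1) f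
    (x := fun h => τ h s) fun h => mem_closedBall_zero_iff.2
      (norm_edgeDir ((P h).edge_ne_zero ((P h).index_lt hL s))).le
  choose G hG1 hG using fun s => exists_tendsto_of_forall_mem (isCompact_Icc (a := 0) (b := M)) f
    (x := fun h => F h s) fun h => ⟨hF0 h s, hFM h s⟩
  refine ⟨u, G, ⟨fun a _ b _ hab => le_of_tendsto_of_tendsto' (hG a) (hG b) fun h => hFm h hab,
    fun a ha b hb hab => ?_⟩, by linarith [(hG1 L).2, (hG1 0).1], fun a ha b hb s has hsb => ?_⟩
  · have hr : Tendsto (fun h => (F h b - F h a) * (b - a + δ h) ^ (p - 1)) f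
        (𝓝 ((G b - G a) * (b - a + 0) ^ (p - 1))) :=
      ((hG b).sub (hG a)).mul ((tendsto_const_nhds.add hδ).rpow_const (Or.inr (by linarith)))
    rw [add_zero] at hr
    refine le_of_tendsto_of_tendsto (((hu b).sub (hu a)).norm.rpow_const (Or.inr hp0.le)) hr ?_
    filter_upwards [hmesh] with h hh
    have := (P h).norm_edgeDir_index_sub_rpow_le hc hL hp hh ha hb le_rfl
      ((P h).index_mono hab) le_rfl
    rwa [Finset.sum_Ico_eq_sub _ ((P h).index_mono hab)] at this
  · have hr : Tendsto (fun h => 4 * δ h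
        + (b - a + δ h) * (M * (b - a + δ h) ^ (p - 1)) ^ p⁻¹) f
        (𝓝 (4 * 0 + (b - a + 0) * (M * (b - a + 0) ^ (p - 1)) ^ p⁻¹)) := by
      have h1 : Tendsto (fun h => b - a + δ h) f (𝓝 (b - a + 0)) := tendsto_const_nhds.add hδ
      refine (tendsto_const_nhds.mul hδ).add (h1.mul ?_)
      exact (tendsto_const_nhds.mul (h1.rpow_const (Or.inr (by linarith)))).rpow_const
        (Or.inr (inv_nonneg.2 hp0.le))
    rw [mul_zero, zero_add, add_zero] at hr
    refine le_of_tendsto_of_tendsto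
      ((tendsto_const_nhds (x := c b - c a)).sub ((hu s).const_smul (b - a))).norm hr ?_
    filter_upwards [hmesh] with h hh
    refine (P h).norm_sub_sub_smul_edgeDir_le hc hL hp hh (hM h) ?_ ha hb has hsb
    exact le_add_of_nonneg_right ENNReal.toReal_nonneg

omit [FiniteDimensional ℝ E] in
-- The factor multiplying `b - a` in the error tends to zero because `p > 1`. Taking `s` as left or
-- right endpoint gives the two one-sided estimates.
lemma hasDerivAt_of_norm_sub_le (hp : 1 < p) {u : ℝ → E}
    (h : ∀ a ∈ Icc 0 L, ∀ b ∈ Icc 0 L, ∀ s, a ≤ s → s ≤ b →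
      ‖c b - c a - (b - a) • u s‖ ≤ (b - a) * (M * (b - a) ^ (p - 1)) ^ p⁻¹)
    {s : ℝ} (hs : s ∈ Ioo 0 L) : HasDerivAt c (u s) s := by
  have hs' := Ioo_subset_Icc_self hs
  rw [hasDerivAt_iff_isLittleO]
  refine Asymptotics.IsLittleO.of_bound fun ε hε => ?_
  have ht : Tendsto (fun x => (M * |x - s| ^ (p - 1)) ^ p⁻¹) (𝓝 s) (𝓝 0) := by
    have h1 : Tendsto (fun x => |x - s|) (𝓝 s) (𝓝 0) := by
      have : Continuous fun x => |x - s| := by fun_prop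
      simpa using this.tendsto s
    have h2 := ((tendsto_const_nhds (x := M)).mul
      (h1.rpow_const (p := p - 1) (Or.inr (by linarith)))).rpow_const (p := p⁻¹)
      (Or.inr (inv_nonneg.2 (by linarith)))
    rwa [Real.zero_rpow (by linarith), mul_zero, Real.zero_rpow (inv_ne_zero (by linarith))] at h2
  filter_upwards [ht.eventually_lt_const hε, Ioo_mem_nhds hs.1 hs.2] with x hx1 hx2
  have hx2' := Ioo_subset_Icc_self hx2
  have key : ‖c x - c s - (x - s) • u s‖ ≤ |x - s| * (M * |x - s| ^ (p - 1)) ^ p⁻¹ := by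
    rcases le_total s x with hle | hle
    · rw [abs_of_nonneg (sub_nonneg.2 hle)]
      exact h s hs' x hx2' s le_rfl hle
    · rw [abs_sub_comm, abs_of_nonneg (sub_nonneg.2 hle), ← norm_neg]
      convert! h x hx2' s hs' s hle le_rfl using 2
      module
  refine key.trans ?_
  rw [mul_comm, Real.norm_eq_abs]
  exact mul_le_mul_of_nonneg_right hx1.le (abs_nonneg _)

lemma exists_isPrimitive_of_cornerBound_le (hL : 0 < L) (hp : 1 < p)
    (hc : HasUnitSpeedOn c (Icc 0 L)) {P : ℕ → InscribedPolygonal c L}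
    (hP : Tendsto (fun h => (P h).modulus) atTop (𝓝 0))
    (hM : ∀ h, ∑ k ∈ Finset.range ((P h).n - 1), cornerBound p (P h).vertex k ≤ M) :
    ∃ u g : ℝ → E, IsPrimitive c u L ∧ IsPrimitive u g L ∧
      MemLp g (ENNReal.ofReal p) (volume.restrict (Ioo 0 L)) ∧
      ∫⁻ s in Ioo 0 L, ‖g s‖ₑ ^ p ≤ ENNReal.ofReal M := by
  obtain ⟨u, F, hd, hFM, hcu⟩ := exists_tangent hL hp hc hP hM
  obtain ⟨g, hg, hgp, hgM⟩ := hd.exists_isPrimitive hp hL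
  have huc := hg.continuousOn hL.le
  have hcc := (lipschitzOnWith_of_hasUnitSpeedOn hc).continuousOn
  have hui : ∀ s ∈ Icc 0 L, IntervalIntegrable u volume 0 s := fun s hs => by
    refine ContinuousOn.intervalIntegrable ?_
    rw [uIcc_of_le hs.1]
    exact huc.mono (Icc_subset_Icc_right hs.2)
  refine ⟨u, g, ⟨hui L ⟨hL.le, le_rfl⟩, fun s hs => ?_⟩, hg, hgp,
    hgM.trans (ENNReal.ofReal_le_ofReal hFM)⟩
  rw [intervalIntegral.integral_eq_sub_of_hasDerivAt_of_le hs.1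
    (hcc.mono (Icc_subset_Icc_right hs.2)) (fun x hx => hasDerivAt_of_norm_sub_le hp hcu
      ⟨hx.1, hx.2.trans_le hs.2⟩) (hui s hs), add_sub_cancel]

/-- Bounds for the relaxed functional give bounds for the `p`-energy of the second derivative. -/
lemma exists_isPrimitive_of_pCurvature_lt (hL : 0 < L) (hp : 1 < p)
    (hc : HasUnitSpeedOn c (Icc 0 L)) (h : pCurvature p c L < ENNReal.ofReal M) :
    ∃ u g : ℝ → E, IsPrimitive c u L ∧ IsPrimitive u g L ∧
      MemLp g (ENNReal.ofReal p) (volume.restrict (Ioo 0 L)) ∧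
      ∫⁻ s in Ioo 0 L, ‖g s‖ₑ ^ p ≤ ENNReal.ofReal M := by
  simp only [pCurvature, iInf_lt_iff] at h
  obtain ⟨P, hP, hlim⟩ := h
  -- Along a subsequence the `p`-rotations stay below `M`; being finite, they exclude turning angles
  -- equal to `π`.
  obtain ⟨φ, hφ, hφM⟩ := extraction_of_frequently_atTop
    (frequently_lt_of_liminf_lt (by isBoundedDefault) hlim)
  refine exists_isPrimitive_of_cornerBound_le hL hp hc (P := P ∘ φ) (hP.comp hφ.tendsto_atTop)
    fun h => ?_
  have hh := hφM h
  have hπ : ∀ i, i + 1 < (P (φ h)).n → turningAngle (P (φ h)).vertex i ≠ Real.pi := by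
    intro i hi hi'
    rw [pRotation, if_pos ⟨i, hi, hi'⟩] at hh
    exact not_top_lt hh
  rw [pRotation_eq_sum hp (fun i hi => (P (φ h)).edge_ne_zero hi) hπ,
    ENNReal.ofReal_lt_ofReal_iff'] at hh
  refine le_trans (Finset.sum_le_sum fun k hk => ?_) hh.1.le
  refine cornerBound_le_cornerEnergy hp (hπ k ?_)
  have := Finset.mem_range.1 hk
  simp only [Function.comp_apply] at this
  omega

end LowerBound

/-! ### Integral estimates for second differences -/

section Integrals

lemma lintegral_rpow_le {α : Type*} [MeasurableSpace α] {μ : Measure α} {f : α → ℝ≥0∞}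
    (hf : AEMeasurable f μ) {p : ℝ} (hp : 1 < p) :
    (∫⁻ x, f x ∂μ) ^ p ≤ μ univ ^ (p - 1) * ∫⁻ x, f x ^ p ∂μ := by
  have hp0 : 0 < p := by linarith
  have hpq := Real.HolderConjugate.conjExponent hp
  have h := ENNReal.lintegral_mul_le_Lp_mul_Lq μ hpq hf (aemeasurable_const (b := (1 : ℝ≥0∞)))
  simp only [Pi.mul_apply, mul_one, ENNReal.one_rpow, lintegral_const, one_mul] at h
  refine (ENNReal.rpow_le_rpow h hp0.le).trans_eq ?_
  rw [ENNReal.mul_rpow_of_nonneg _ _ hp0.le, ← ENNReal.rpow_mul, ← ENNReal.rpow_mul,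
    one_div_mul_cancel hp0.ne', ENNReal.rpow_one, mul_comm]
  congr 2
  rw [one_div_mul_eq_div, Real.conjExponent]
  field_simp

/-- By Tonelli: a point `r` lies in the window `(s, s + h]` exactly for `s ∈ [r - h, r)`. -/
lemma lintegral_lintegral_Ioc {G : ℝ → ℝ≥0∞} (hG : AEMeasurable G) (h : ℝ) :
    ∫⁻ s, ∫⁻ r in Ioc s (s + h), G r = ENNReal.ofReal h * ∫⁻ r, G r := by
  set T : Set (ℝ × ℝ) := {q | q.1 < q.2 ∧ q.2 ≤ q.1 + h}
  have hT : MeasurableSet T :=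
    (measurableSet_lt measurable_fst measurable_snd).inter
      (measurableSet_le measurable_snd (measurable_fst.add_const h))
  have h1 : ∀ s, ∫⁻ r in Ioc s (s + h), G r = ∫⁻ r, T.indicator (fun q => G q.2) (s, r) := by
    intro s
    rw [← lintegral_indicator measurableSet_Ioc]
    rfl
  have h2 : ∀ r, ∫⁻ s, T.indicator (fun q => G q.2) (s, r) = ENNReal.ofReal h * G r := by
    intro r
    have : ∀ s, T.indicator (fun q => G q.2) (s, r) = (Ico (r - h) r).indicator (fun _ => G r) s := by
      intro s
      by_cases hs : s ∈ Ico (r - h) r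
      · rw [indicator_of_mem hs, indicator_of_mem]
        exact ⟨hs.2, by linarith [hs.1]⟩
      · rw [indicator_of_notMem hs, indicator_of_notMem]
        exact fun hq => hs ⟨by linarith [hq.2], hq.1⟩
    simp_rw [this]
    rw [lintegral_indicator measurableSet_Ico, setLIntegral_const, Real.volume_Ico, sub_sub_cancel,
      mul_comm]
  simp_rw [h1]
  rw [lintegral_lintegral_swap]
  · simp_rw [h2]
    rw [lintegral_const_mul' _ _ ENNReal.ofReal_ne_top]
  · exact (hG.comp_quasiMeasurePreserving Measure.quasiMeasurePreserving_snd).indicator hT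

variable {E : Type*} [NormedAddCommGroup E] [NormedSpace ℝ E] {u v g : ℝ → E} {L p h : ℝ}

lemma IsPrimitive.enorm_sub_rpow_le (hu : IsPrimitive u g L) (hp : 1 < p) (hh : 0 ≤ h) {s : ℝ}
    (hs : s ∈ Icc 0 (L - h)) :
    ‖u (s + h) - u s‖ₑ ^ p ≤ ENNReal.ofReal h ^ (p - 1) * ∫⁻ r in Ioc s (s + h), ‖g r‖ₑ ^ p := by
  have h1 : s ∈ Icc 0 L := ⟨hs.1, by linarith [hs.2]⟩
  have h2 : s + h ∈ Icc 0 L := ⟨by linarith [hs.1], by linarith [hs.2]⟩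
  have hi := (intervalIntegrable_iff_integrableOn_Ioc_of_le (by linarith)).1
    (hu.intervalIntegrable h1 h2)
  rw [hu.sub_eq h1 h2, intervalIntegral.integral_of_le (by linarith)]
  refine (ENNReal.rpow_le_rpow (enorm_integral_le_lintegral_enorm _) (by linarith)).trans ?_
  refine (lintegral_rpow_le hi.1.enorm hp).trans_eq ?_
  simp

/-- A second difference of `u` is a first difference of `s ↦ u (s + h) - u s`, so the Hölder
estimate for primitives can be applied twice. -/
lemma IsPrimitive.translate_sub (hu : IsPrimitive u g L) (hh : h ∈ Icc 0 L) :
    IsPrimitive (fun s => u (s + h) - u s) (fun s => g (s + h) - g s) (L - h) := by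
  have h0 : (0 : ℝ) ∈ Icc 0 L := ⟨le_rfl, hh.1.trans hh.2⟩
  have hi : ∀ s ∈ Icc 0 (L - h), IntervalIntegrable (fun s => g (s + h)) volume 0 s ∧
      IntervalIntegrable g volume 0 s := by
    intro s hs
    have hsh : s + h ∈ Icc 0 L := ⟨by linarith [hs.1, hh.1], by linarith [hs.2]⟩
    refine ⟨?_, hu.intervalIntegrable h0 ⟨hs.1, by linarith [hs.2, hh.1]⟩⟩
    simpa using (hu.intervalIntegrable hh hsh).comp_add_right h
  refine ⟨?_, fun s hs => ?_⟩
  · have := hi (L - h) ⟨by linarith [hh.2], le_rfl⟩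
    exact this.1.sub this.2
  · have hsh : s + h ∈ Icc 0 L := ⟨by linarith [hs.1, hh.1], by linarith [hs.2]⟩
    have hs' : s ∈ Icc 0 L := ⟨hs.1, by linarith [hs.2, hh.1]⟩
    rw [intervalIntegral.integral_sub (hi s hs).1 (hi s hs).2,
      intervalIntegral.integral_comp_add_right, zero_add, ← hu.sub_eq hh hsh, ← hu.sub_eq h0 hs']
    simp only [zero_add]
    abel

/-- Estimate of the second differences on a uniform partition. -/
lemma sum_second_difference_le (hu : IsPrimitive u v L) (hv : IsPrimitive v g L) (hp : 1 < p)
    {n : ℕ} (hn : 1 ≤ n) (hL : 0 < L) (hh : h = L / n) :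
    ∑ i ∈ Finset.range (n - 1),
      ‖(u ((i + 1 + 1) * h) - u ((i + 1) * h)) - (u ((i + 1) * h) - u (i * h))‖ₑ ^ p
      ≤ ENNReal.ofReal h ^ (2 * p - 1) * ∫⁻ r in Ioo 0 L, ‖g r‖ₑ ^ p := by
  have hn0 : (0 : ℝ) < n := by exact_mod_cast hn
  have hh0 : 0 < h := hh ▸ div_pos hL hn0
  have hnh : n * h = L := by rw [hh]; field_simp
  have hhL : h ∈ Icc 0 L := by
    refine ⟨hh0.le, ?_⟩
    rw [← hnh]
    exact le_mul_of_one_le_left hh0.le (by exact_mod_cast hn)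
  have hw := hu.translate_sub hhL
  -- Extending the integrand by zero allows Tonelli on the whole line.
  set G : ℝ → ℝ≥0∞ := (Ioc 0 L).indicator fun r => ‖g r‖ₑ ^ p with hG
  have hGm : AEMeasurable G := by
    refine (aemeasurable_indicator_iff measurableSet_Ioc).2 ?_
    exact ((intervalIntegrable_iff_integrableOn_Ioc_of_le hL.le).1 hv.1).1.enorm.pow_const p
  have hGi : ∫⁻ r, G r = ∫⁻ r in Ioo 0 L, ‖g r‖ₑ ^ p := by
    rw [hG, lintegral_indicator measurableSet_Ioc, restrict_Ioo_eq_restrict_Ioc]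
  -- Hölder is used once for the translated difference of `u` and once for `v`, each time costing `h
  -- ^ (p - 1)`. Tonelli later supplies one more factor `h`, whence the exponent `2 * p - 1`.
  have hterm : ∀ i ∈ Finset.range (n - 1),
      ‖(u ((i + 1 + 1) * h) - u ((i + 1) * h)) - (u ((i + 1) * h) - u (i * h))‖ₑ ^ p
      ≤ ENNReal.ofReal h ^ (2 * (p - 1)) * ∫⁻ s in Ioc (i * h) (((i + 1 : ℕ) : ℝ) * h),
        ∫⁻ r in Ioc s (s + h), G r := by
    intro i hi
    have hi' : (i : ℝ) + 2 ≤ n := by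
      have := Finset.mem_range.1 hi
      have : i + 2 ≤ n := by omega
      exact_mod_cast this
    have hih : (i : ℝ) * h + 2 * h ≤ L := by
      rw [← hnh, ← add_mul]; gcongr
    have hi0 : 0 ≤ (i : ℝ) * h := by positivity
    have e1 := hw.enorm_sub_rpow_le (h := h) hp hh0.le (s := i * h) ⟨hi0, by linarith⟩
    have e2 : (i : ℝ) * h + h = (i + 1) * h := by ring
    have e3 : ((i : ℝ) + 1) * h + h = (i + 1 + 1) * h := by ring
    rw [e2, e3] at e1
    refine e1.trans ?_
    have hpow : ENNReal.ofReal h ^ (2 * (p - 1))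
        = ENNReal.ofReal h ^ (p - 1) * ENNReal.ofReal h ^ (p - 1) := by
      rw [two_mul, ENNReal.rpow_add_of_nonneg _ _ (by linarith) (by linarith)]
    rw [hpow, mul_assoc]
    gcongr
    rw [← lintegral_const_mul' _ _ (ENNReal.rpow_ne_top_of_nonneg (by linarith)
      ENNReal.ofReal_ne_top)]
    push_cast
    refine setLIntegral_mono' measurableSet_Ioc fun s hs => ?_
    have hsL : s + h ≤ L := by rw [← e2] at hs; linarith [hs.2]
    refine (hv.enorm_sub_rpow_le hp hh0.le ⟨hi0.trans hs.1.le, by linarith⟩).trans ?_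
    refine mul_le_mul' le_rfl (setLIntegral_congr_fun measurableSet_Ioc fun r hr => ?_).le
    rw [hG, indicator_of_mem]
    exact ⟨(hi0.trans hs.1.le).trans_lt hr.1, hr.2.trans hsL⟩
  refine (Finset.sum_le_sum hterm).trans ?_
  rw [← Finset.mul_sum, ← lintegral_biUnion_finset]
  · have hle : ∫⁻ s in ⋃ i ∈ Finset.range (n - 1), Ioc (i * h) (((i + 1 : ℕ) : ℝ) * h),
        ∫⁻ r in Ioc s (s + h), G r ≤ ENNReal.ofReal h * ∫⁻ r, G r := by
      rw [← lintegral_lintegral_Ioc hGm]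
      exact setLIntegral_le_lintegral _ _
    refine (mul_le_mul_right hle _).trans_eq ?_
    rw [← mul_assoc, hGi]
    congr 1
    nth_rw 2 [← ENNReal.rpow_one (ENNReal.ofReal h)]
    rw [← ENNReal.rpow_add_of_nonneg _ _ (by linarith) zero_le_one]
    congr 1
    ring
  · have hm : Monotone fun i : ℕ => (i : ℝ) * h := fun i j hij => by
      simp only; gcongr
    exact fun i _ j _ hij => hm.pairwise_disjoint_on_Ioc_succ hij
  · exact fun i _ => measurableSet_Ioc

end Integrals

/-! ### Upper bound for the energy of one corner -/

section CornerUpperBound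

variable {E : Type*} [NormedAddCommGroup E] [InnerProductSpace ℝ E] {v : ℕ → E} {i : ℕ}
  {p ρ σ : ℝ}

/-- With edges `e`, `e'`, one has `‖e' - e‖² = (‖e'‖ - ‖e‖)² + 2 ‖e‖ ‖e'‖ (1 - cos θ)`, and the
square of the corner size is at most `‖e‖ ‖e'‖`. -/
lemma cornerSize_mul_le (h : edge v i ≠ 0) (h' : edge v (i + 1) ≠ 0) :
    cornerSize v i * (2 * Real.sin (turningAngle v i / 2)) ≤ ‖edge v (i + 1) - edge v i‖ := by
  rw [← norm_edgeDir_sub h h']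
  have hr := cornerSize_nonneg v i
  rw [← sq_le_sq₀ (mul_nonneg hr (norm_nonneg _)) (norm_nonneg _), mul_pow, norm_sub_sq_real,
    norm_sub_sq_real, norm_edgeDir h, norm_edgeDir h', real_inner_comm, inner_edgeDir h h']
  have hin : inner ℝ (edge v (i + 1)) (edge v i)
      = Real.cos (turningAngle v i) * (‖edge v i‖ * ‖edge v (i + 1)‖) := by
    rw [real_inner_comm, turningAngle, InnerProductGeometry.cos_angle_mul_norm_mul_norm]
  rw [hin]
  have h1 : cornerSize v i ≤ ‖edge v i‖ := min_le_left _ _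
  have h2 : cornerSize v i ≤ ‖edge v (i + 1)‖ := min_le_right _ _
  have h3 : cornerSize v i ^ 2 ≤ ‖edge v i‖ * ‖edge v (i + 1)‖ := by
    rw [sq]; exact mul_le_mul h1 h2 hr (norm_nonneg _)
  have h4 := Real.cos_le_one (turningAngle v i)
  nlinarith [sq_nonneg (‖edge v i‖ - ‖edge v (i + 1)‖),
    mul_le_mul_of_nonneg_right h3 (sub_nonneg.2 h4)]

/-- The previous bound gives `2 sin (θ / 2) ≤ d / ρ ≤ σ`, where `d` is the norm of the difference of
the edges. This excludes `θ = π` and forces `cos (θ / 2) ≥ 1 - σ`. Hence both `θ` and `2 tan (θ /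
2)` are at most `d / (ρ (1 - σ))`. -/
lemma cornerEnergy_le (hp : 1 < p) (hρ : 0 < ρ) (h : ρ ≤ ‖edge v i‖) (h' : ρ ≤ ‖edge v (i + 1)‖)
    (hσ0 : 0 ≤ σ) (hσ : σ < 1) (hd : ‖edge v (i + 1) - edge v i‖ ≤ σ * ρ) :
    turningAngle v i ≠ Real.pi ∧ cornerEnergy p v i
      ≤ ((1 - σ) ^ p)⁻¹ * (ρ ^ (2 * p - 1))⁻¹ * ‖edge v (i + 1) - edge v i‖ ^ p := by
  have hv : edge v i ≠ 0 := norm_pos_iff.1 (hρ.trans_le h)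
  have hv' : edge v (i + 1) ≠ 0 := norm_pos_iff.1 (hρ.trans_le h')
  have hr : ρ ≤ cornerSize v i := le_min h h'
  have hr0 : 0 < cornerSize v i := hρ.trans_le hr
  have hk := cornerSize_mul_le hv hv'
  set θ := turningAngle v i
  set d := ‖edge v (i + 1) - edge v i‖
  have hθ0 : 0 ≤ θ := turningAngle_nonneg v i
  have hθπ : θ ≤ Real.pi := turningAngle_le_pi v i
  have hsin0 : 0 ≤ Real.sin (θ / 2) :=
    Real.sin_nonneg_of_nonneg_of_le_pi (by linarith) (by linarith [Real.pi_pos])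
  have hsd : 2 * Real.sin (θ / 2) ≤ d / ρ := by
    rw [le_div_iff₀ hρ, mul_comm]
    exact (mul_le_mul_of_nonneg_right hr (by linarith)).trans hk
  have hdσ : d / ρ ≤ σ := (div_le_iff₀ hρ).2 hd
  have hne : θ ≠ Real.pi := by
    intro hθ
    rw [hθ, Real.sin_pi_div_two] at hsd
    linarith
  refine ⟨hne, ?_⟩
  have hlt : θ < Real.pi := lt_of_le_of_ne hθπ hne
  have hcos : 0 < Real.cos (θ / 2) :=
    Real.cos_pos_of_mem_Ioo ⟨by linarith [Real.pi_pos], by linarith⟩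
  have hcosσ : 1 - σ ≤ Real.cos (θ / 2) := by
    have h1 := Real.sin_sq_add_cos_sq (θ / 2)
    have h2 := Real.cos_le_one (θ / 2)
    nlinarith
  have htan : 2 * Real.tan (θ / 2) ≤ d / ρ / (1 - σ) := by
    rw [Real.tan_eq_sin_div_cos, ← mul_div_assoc]
    exact div_le_div₀ (by linarith) hsd (by linarith) hcosσ
  have htan0 : 0 ≤ Real.tan (θ / 2) := tan_half_turningAngle_nonneg v i
  have hle : θ ≤ 2 * Real.tan (θ / 2) := by
    have := Real.le_tan (show 0 ≤ θ / 2 by linarith) (by linarith)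
    linarith
  have hd0 : 0 ≤ d := norm_nonneg _
  have hX : 0 ≤ d / ρ / (1 - σ) := div_nonneg (div_nonneg hd0 hρ.le) (by linarith)
  calc cornerEnergy p v i
      ≤ (d / ρ / (1 - σ)) * (d / ρ / (1 - σ) / ρ) ^ (p - 1) := by
        refine mul_le_mul (hle.trans htan) (Real.rpow_le_rpow ?_ ?_ (by linarith))
          (Real.rpow_nonneg ?_ _) hX
        · positivity
        · exact div_le_div₀ hX htan hρ hr
        · positivity
    _ = _ := by
        rcases hd0.eq_or_lt with h0 | h0
        · rw [← h0, Real.zero_rpow (by linarith)]; simp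
        have hσ' : 0 < 1 - σ := by linarith
        rw [Real.rpow_sub_one (by positivity), Real.div_rpow hX hρ.le, Real.div_rpow (by positivity)
          hσ'.le, Real.div_rpow hd0 hρ.le, Real.rpow_sub_one hρ.ne', two_mul,
          Real.rpow_add hρ]
        field_simp

end CornerUpperBound

/-! ### Upper bound: uniform inscribed polygonals -/

section UpperBound

variable {E : Type*} [NormedAddCommGroup E] {c u g : ℝ → E} {L p h ε : ℝ}

/-- On `[a, b]` the curve is `K`-Lipschitz, so its length `b - a` is at most `K (b - a)`. This takes
the place of the identity `‖u‖ = 1`. -/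
lemma one_le_of_norm_le [NormedSpace ℝ E] (hc : HasUnitSpeedOn c (Icc 0 L))
    (hu : IsPrimitive c u L) {a b K : ℝ} (ha : a ∈ Icc 0 L) (hb : b ∈ Icc 0 L) (hab : a < b)
    (hK : ∀ s ∈ Icc a b, ‖u s‖ ≤ K) : 1 ≤ K := by
  have hK0 : 0 ≤ K := (norm_nonneg _).trans (hK a (left_mem_Icc.2 hab.le))
  have hsub : Icc a b ⊆ Icc 0 L := Icc_subset_Icc ha.1 hb.2
  have hlip : LipschitzOnWith K.toNNReal c (Icc a b) := by
    refine LipschitzOnWith.of_dist_le_mul fun x hx y hy => ?_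
    rw [dist_eq_norm, Real.dist_eq, Real.coe_toNNReal _ hK0, hu.sub_eq (hsub hy) (hsub hx)]
    exact intervalIntegral.norm_integral_le_of_norm_le_const fun s hs =>
      hK s (uIcc_subset_Icc hy hx (uIoc_subset_uIcc hs))
  have h1 := hlip.comp_eVariationOn_le (mapsTo_id (Icc a b))
  have h2 : eVariationOn c (Icc 0 L ∩ Icc a b) = ENNReal.ofReal (b - a) := by
    simpa using hc ha hb
  rw [inter_eq_right.2 hsub] at h2
  rw [Function.comp_id, h2, eVariationOn_id_Icc] at h1
  change _ ≤ ENNReal.ofReal K * _ at h1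
  rw [← ENNReal.ofReal_mul hK0, ENNReal.ofReal_le_ofReal_iff
    (mul_nonneg hK0 (sub_nonneg.2 hab.le))] at h1
  exact le_of_mul_le_mul_right (by linarith) (sub_pos.2 hab)

/-- The polygonal inscribed in `c` given by the uniform partition in `n` intervals. -/
noncomputable def uniformPolygonal {E : Type*} (c : ℝ → E) {L : ℝ} (hL : 0 < L) (n : ℕ)
    (hn : 0 < n) (hne : ∀ i < n, c (i * (L / n)) ≠ c ((i + 1) * (L / n))) :
    InscribedPolygonal c L where
  n := n
  t i := i * (L / n)
  t_zero := by simp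
  t_last := by field_simp
  t_lt i _ := by
    have : 0 < L / n := by positivity
    push_cast
    linarith
  nondegenerate i hi := by simpa using hne i hi

lemma modulus_uniformPolygonal_le (hc : HasUnitSpeedOn c (Icc 0 L)) (hL : 0 < L) {n : ℕ}
    (hn : 0 < n) (hne : ∀ i < n, c (i * (L / n)) ≠ c ((i + 1) * (L / n))) :
    (uniformPolygonal c hL n hn hne).modulus ≤ ENNReal.ofReal (L / n) := by
  set P := uniformPolygonal c hL n hn hne
  refine iSup₂_le fun i hi => Metric.ediam_le ?_
  have hi' : i < P.n := Finset.mem_range.1 hi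
  rintro _ ⟨x, hx, rfl⟩ _ ⟨y, hy, rfl⟩
  have hsub : Icc (P.t i) (P.t (i + 1)) ⊆ Icc 0 L :=
    Icc_subset_Icc (P.t_mem hi'.le).1 (P.t_mem hi').2
  have h1 := (lipschitzOnWith_of_hasUnitSpeedOn hc).dist_le_mul x (hsub hx) y (hsub hy)
  rw [edist_dist]
  refine ENNReal.ofReal_le_ofReal (h1.trans ?_)
  rw [NNReal.coe_one, one_mul]
  refine (Real.dist_le_of_mem_Icc hx hy).trans_eq ?_
  simp only [P, uniformPolygonal]
  push_cast
  ring

variable [InnerProductSpace ℝ E]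

lemma norm_second_difference_le (hu : IsPrimitive c u L)
    (hh : 0 < h) (hε : ∀ x ∈ Icc 0 L, ∀ y ∈ Icc 0 L, |x - y| ≤ h → ‖u x - u y‖ ≤ ε)
    {a : ℝ} (ha : 0 ≤ a) (haL : a + h + h ≤ L) :
    ‖(c (a + h + h) - c (a + h)) - (c (a + h) - c a)‖ ≤ ε * h := by
  have hw := hu.translate_sub (h := h) ⟨hh.le, by linarith⟩
  have h1 := hw.sub_eq (s := a) (t := a + h) ⟨ha, by linarith⟩ ⟨by linarith, by linarith⟩
  rw [h1]
  refine (intervalIntegral.norm_integral_le_of_norm_le_const (C := ε) fun s hs => ?_).trans_eq ?_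
  · rw [uIoc_of_le (by linarith)] at hs
    refine hε _ ⟨by linarith [hs.1], by linarith [hs.2]⟩ _ ⟨by linarith [hs.1],
      by linarith [hs.2]⟩ ?_
    rw [add_sub_cancel_left, abs_of_pos hh]
  · rw [add_sub_cancel_left, abs_of_pos hh]

variable [CompleteSpace E]

/-- One `ε` is lost in `‖u a‖ ≥ 1 - ε`, the other in replacing `u` by `u a` under the integral. -/
lemma le_norm_sub_of_oscillation_le (hc : HasUnitSpeedOn c (Icc 0 L)) (hu : IsPrimitive c u L)
    (hh : 0 < h) (hε : ∀ x ∈ Icc 0 L, ∀ y ∈ Icc 0 L, |x - y| ≤ h → ‖u x - u y‖ ≤ ε)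
    {a : ℝ} (ha : a ∈ Icc 0 (L - h)) : (1 - 2 * ε) * h ≤ ‖c (a + h) - c a‖ := by
  have ha' : a ∈ Icc 0 L := ⟨ha.1, by linarith [ha.2]⟩
  have hb' : a + h ∈ Icc 0 L := ⟨by linarith [ha.1], by linarith [ha.2]⟩
  have hosc : ∀ s ∈ Icc a (a + h), ‖u s - u a‖ ≤ ε := fun s hs =>
    hε s (Icc_subset_Icc ha'.1 hb'.2 hs) a ha' (by
      rw [abs_of_nonneg (sub_nonneg.2 hs.1)]; linarith [hs.2])
  have h1 : 1 ≤ ‖u a‖ + ε := one_le_of_norm_le hc hu ha' hb' (by linarith) fun s hs => by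
    have := norm_sub_norm_le (u s) (u a)
    linarith [hosc s hs]
  have h2 : c (a + h) - c a = h • u a + ∫ s in a..(a + h), (u s - u a) := by
    rw [intervalIntegral.integral_sub (hu.intervalIntegrable ha' hb')
      intervalIntegrable_const, ← hu.sub_eq ha' hb', intervalIntegral.integral_const,
      add_sub_cancel_left]
    abel
  have h3 : ‖∫ s in a..(a + h), (u s - u a)‖ ≤ ε * h := by
    refine (intervalIntegral.norm_integral_le_of_norm_le_const (C := ε) fun s hs => ?_).trans_eq ?_
    · rw [uIoc_of_le (by linarith)] at hs
      exact hosc s (Ioc_subset_Icc_self hs)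
    · rw [add_sub_cancel_left, abs_of_pos hh]
  have h4 : ‖h • u a‖ = h * ‖u a‖ := by rw [norm_smul, Real.norm_of_nonneg hh.le]
  have h5 := norm_sub_le_norm_add (h • u a) (∫ s in a..(a + h), (u s - u a))
  rw [h2]
  nlinarith

/-- The factor by which the `p`-rotation of a uniform polygonal exceeds at most the energy, in
terms of the oscillation of the tangent. -/
noncomputable def excess (p ε : ℝ) : ℝ :=
  ((1 - ε / (1 - 2 * ε)) ^ p)⁻¹ * ((1 - 2 * ε) ^ (2 * p - 1))⁻¹

lemma pRotation_uniform_le (hc : HasUnitSpeedOn c (Icc 0 L)) (hu : IsPrimitive c u L)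
    (hg : IsPrimitive u g L) (hp : 1 < p) (hL : 0 < L) {n : ℕ} (hn : 1 ≤ n) (hh : h = L / n)
    (hε0 : 0 < ε) (hε1 : ε < 1 / 4)
    (hε : ∀ x ∈ Icc 0 L, ∀ y ∈ Icc 0 L, |x - y| ≤ h → ‖u x - u y‖ ≤ ε)
    {v : ℕ → E} (hv : ∀ i : ℕ, v i = c (i * h)) :
    (∀ i < n, edge v i ≠ 0) ∧
    pRotation p v n ≤ ENNReal.ofReal (excess p ε) * ∫⁻ s in Ioo 0 L, ‖g s‖ₑ ^ p := by
  have hn0 : (0 : ℝ) < n := by exact_mod_cast hn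
  have hh0 : 0 < h := hh ▸ div_pos hL hn0
  have hnh : n * h = L := by rw [hh]; field_simp
  have hρ : 0 < (1 - 2 * ε) * h := mul_pos (by linarith) hh0
  have hedge : ∀ i, edge v i = c ((i + 1) * h) - c (i * h) := fun i => by
    rw [edge, hv, hv]; push_cast; rfl
  have hlen : ∀ i < n, (1 - 2 * ε) * h ≤ ‖edge v i‖ := fun i hi => by
    have hi' : (i : ℝ) + 1 ≤ n := by exact_mod_cast hi
    have h1 := le_norm_sub_of_oscillation_le hc hu hh0 hε (a := i * h) ⟨by positivity, by
      rw [← hnh]; nlinarith⟩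
    rw [hedge, add_mul, one_mul]
    exact h1
  have he : ∀ i < n, edge v i ≠ 0 := fun i hi => norm_pos_iff.1 (hρ.trans_le (hlen i hi))
  refine ⟨he, ?_⟩
  -- The corner estimate is used with `ρ = (1 - 2 * ε) * h` and `σ = ε / (1 - 2 * ε)`, so that `σ *
  -- ρ = ε * h` is the bound for second differences.
  have hσ0 : 0 ≤ ε / (1 - 2 * ε) := div_nonneg hε0.le (by linarith)
  have hσ1 : ε / (1 - 2 * ε) < 1 := by rw [div_lt_one (by linarith)]; linarith
  have hcorner : ∀ i, i + 1 < n → turningAngle v i ≠ Real.pi ∧ cornerEnergy p v i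
      ≤ ((1 - ε / (1 - 2 * ε)) ^ p)⁻¹ * (((1 - 2 * ε) * h) ^ (2 * p - 1))⁻¹
        * ‖edge v (i + 1) - edge v i‖ ^ p := by
    intro i hi
    refine cornerEnergy_le hp hρ (hlen i (by omega)) (hlen (i + 1) hi) hσ0 hσ1 ?_
    have hi' : (i : ℝ) + 2 ≤ n := by exact_mod_cast hi
    have h1 := norm_second_difference_le hu hh0 hε (a := i * h) (by positivity)
      (by rw [← hnh]; nlinarith)
    have e2 : (i : ℝ) * h + h = (i + 1) * h := by ring
    have e3 : ((i : ℝ) + 1) * h + h = (i + 1 + 1) * h := by ring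
    rw [e2, e3] at h1
    rw [hedge, hedge]
    push_cast
    refine h1.trans_eq ?_
    have : 1 - 2 * ε ≠ 0 := by linarith
    rw [← mul_assoc, div_mul_cancel₀ _ this]
  rw [pRotation_eq_sum hp he fun i hi => (hcorner i hi).1]
  set K := ((1 - ε / (1 - 2 * ε)) ^ p)⁻¹ * (((1 - 2 * ε) * h) ^ (2 * p - 1))⁻¹ with hK
  have hK0 : 0 ≤ K := mul_nonneg (inv_nonneg.2 (Real.rpow_nonneg (by linarith) _))
    (inv_nonneg.2 (Real.rpow_nonneg hρ.le _))
  -- The power of `h` in the corner estimate cancels the one in the estimate of second differences.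
  have hKh : ENNReal.ofReal K * ENNReal.ofReal h ^ (2 * p - 1) = ENNReal.ofReal (excess p ε) := by
    rw [ENNReal.ofReal_rpow_of_pos hh0, ← ENNReal.ofReal_mul hK0]
    congr 1
    have h1 : 0 < h ^ (2 * p - 1) := Real.rpow_pos_of_pos hh0 _
    rw [hK, excess, Real.mul_rpow (by linarith) hh0.le, mul_inv]
    field_simp
  calc ENNReal.ofReal (∑ i ∈ Finset.range (n - 1), cornerEnergy p v i)
      ≤ ENNReal.ofReal (∑ i ∈ Finset.range (n - 1), K * ‖edge v (i + 1) - edge v i‖ ^ p) := by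
        refine ENNReal.ofReal_le_ofReal (Finset.sum_le_sum fun i hi => (hcorner i ?_).2)
        have := Finset.mem_range.1 hi
        omega
    _ = ENNReal.ofReal K * ∑ i ∈ Finset.range (n - 1),
        ‖(c ((i + 1 + 1) * h) - c ((i + 1) * h)) - (c ((i + 1) * h) - c (i * h))‖ₑ ^ p := by
        rw [← Finset.mul_sum, ENNReal.ofReal_mul hK0, ENNReal.ofReal_sum_of_nonneg fun i _ =>
          Real.rpow_nonneg (norm_nonneg _) _]
        congr 1
        refine Finset.sum_congr rfl fun i _ => ?_
        rw [← ENNReal.ofReal_rpow_of_nonneg (norm_nonneg _) (by linarith), ofReal_norm, hedge,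
          hedge]
        push_cast
        rfl
    _ ≤ ENNReal.ofReal K * (ENNReal.ofReal h ^ (2 * p - 1) * ∫⁻ s in Ioo 0 L, ‖g s‖ₑ ^ p) := by
        gcongr
        exact sum_second_difference_le hu hg hp hn hL hh
    _ = _ := by rw [← mul_assoc, hKh]

lemma pCurvature_le_excess_mul (hc : HasUnitSpeedOn c (Icc 0 L)) (hu : IsPrimitive c u L)
    (hg : IsPrimitive u g L) (hp : 1 < p) (hL : 0 < L) (hε0 : 0 < ε) (hε1 : ε < 1 / 4) :
    pCurvature p c L ≤ ENNReal.ofReal (excess p ε) * ∫⁻ s in Ioo 0 L, ‖g s‖ₑ ^ p := by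
  obtain ⟨δ, hδ, hδε⟩ := Metric.uniformContinuousOn_iff_le.1
    (isCompact_Icc.uniformContinuousOn_of_continuous (hg.continuousOn hL.le)) ε hε0
  simp only [dist_eq_norm] at hδε
  -- Using `k + m` intervals keeps every step length below `δ` from `k = 0` on.
  obtain ⟨m, hm⟩ := exists_nat_gt (L / δ)
  have hm0 : (0 : ℝ) < m := (div_pos hL hδ).trans hm
  have hmδ : ∀ k : ℕ, L / ((k + m : ℕ) : ℝ) ≤ δ := fun k => by
    have h1 : (m : ℝ) ≤ ((k + m : ℕ) : ℝ) := by push_cast; linarith [Nat.cast_nonneg (α := ℝ) k]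
    rw [div_le_iff₀ (hm0.trans_le h1)]
    rw [div_lt_iff₀ hδ] at hm
    nlinarith
  have hmn : ∀ k, 1 ≤ k + m := fun k => by
    have : 0 < m := by exact_mod_cast hm0
    omega
  have hmain : ∀ (k : ℕ) (v : ℕ → E), (∀ i : ℕ, v i = c (i * (L / ((k + m : ℕ) : ℝ)))) → _ :=
    fun k v hv => pRotation_uniform_le hc hu hg hp hL (hmn k) rfl hε0 hε1
      (fun x hx y hy hxy => hδε x hx y hy (hxy.trans (hmδ k))) hv
  have hne : ∀ k, ∀ i < k + m, c (i * (L / ((k + m : ℕ) : ℝ)))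
      ≠ c ((i + 1) * (L / ((k + m : ℕ) : ℝ))) := by
    intro k i hi
    have := (hmain k _ fun i => rfl).1 i hi
    rw [edge, sub_ne_zero] at this
    push_cast at this ⊢
    exact this.symm
  let P : ℕ → InscribedPolygonal c L := fun k => uniformPolygonal c hL (k + m) (hmn k) (hne k)
  have hP : Tendsto (fun k => (P k).modulus) atTop (𝓝 0) := by
    have h1 : Tendsto (fun k : ℕ => ENNReal.ofReal (L / ((k + m : ℕ) : ℝ))) atTop (𝓝 0) := by
      rw [← ENNReal.ofReal_zero]
      exact ENNReal.tendsto_ofReal (tendsto_const_nhds.div_atTop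
        (tendsto_natCast_atTop_atTop.comp (tendsto_add_atTop_nat m)))
    exact tendsto_of_tendsto_of_tendsto_of_le_of_le tendsto_const_nhds h1 (fun _ => zero_le)
      fun k => modulus_uniformPolygonal_le hc hL (hmn k) (hne k)
  refine (iInf₂_le P hP).trans ?_
  refine (liminf_le_liminf (Eventually.of_forall fun k =>
    (hmain k (P k).vertex fun i => rfl).2)).trans ?_
  rw [liminf_const]

/-- The relaxed functional is at most the energy. -/
lemma pCurvature_le (hc : HasUnitSpeedOn c (Icc 0 L)) (hu : IsPrimitive c u L)
    (hg : IsPrimitive u g L) (hp : 1 < p) (hL : 0 < L) :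
    pCurvature p c L ≤ ∫⁻ s in Ioo 0 L, ‖g s‖ₑ ^ p := by
  have ht : Tendsto (excess p) (𝓝[>] 0) (𝓝 1) := by
    have h1 : ContinuousAt (excess p) 0 := by
      unfold excess
      have a1 : ContinuousAt (fun ε : ℝ => 1 - 2 * ε) 0 := by fun_prop
      refine ((ContinuousAt.rpow_const (continuousAt_const.sub (continuousAt_id.div a1 ?_))
        ?_).inv₀ ?_).mul ((a1.rpow_const ?_).inv₀ ?_) <;> simp
    have h2 : excess p 0 = 1 := by simp [excess]
    rw [← h2]
    exact h1.tendsto.mono_left nhdsWithin_le_nhds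
  have ht' := ENNReal.Tendsto.mul_const (b := ∫⁻ s in Ioo 0 L, ‖g s‖ₑ ^ p)
    (ENNReal.tendsto_ofReal ht) (Or.inl (by simp))
  rw [ENNReal.ofReal_one, one_mul] at ht'
  refine ge_of_tendsto ht' ?_
  filter_upwards [Ioo_mem_nhdsGT (show (0 : ℝ) < 1 / 4 by norm_num)] with ε hε
  exact pCurvature_le_excess_mul hc hu hg hp hL hε.1 hε.2

end UpperBound

end PCurvature

/-- `c : [0, L] → ℝ^{N+1}` is the arc-length parameterization of an open (that is, not closed)
rectifiable curve of length `L`. -/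
theorem theorem1p1 (N : ℕ) (hN : 1 ≤ N) (L : ℝ) (hL : 0 < L)
    (c : ℝ → EuclideanSpace ℝ (Fin (N + 1)))
    (hc : HasUnitSpeedOn c (Set.Icc 0 L)) (hopen : c 0 ≠ c L)
    (p : ℝ) (hp : 1 < p) :
    (PCurvature.pCurvature p c L < ⊤ ↔
      PCurvature.MemSobolev 2 (ENNReal.ofReal p) c 0 L) ∧
    (PCurvature.pCurvature p c L < ⊤ →
      ∀ g : ℝ → EuclideanSpace ℝ (Fin (N + 1)), PCurvature.IsWeakDeriv 2 c g 0 L →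
        PCurvature.pCurvature p c L = ∫⁻ s in Set.Ioo 0 L, ‖g s‖ₑ ^ p) := by
  have hlower : ∀ M, PCurvature.pCurvature p c L < ENNReal.ofReal M → _ := fun M hM =>
    PCurvature.exists_isPrimitive_of_pCurvature_lt hL hp hc hM
  have hreal : PCurvature.pCurvature p c L < ⊤ →
      ∃ M, PCurvature.pCurvature p c L < ENNReal.ofReal M := fun h => by
    obtain ⟨M, hM, hM'⟩ := exists_between h
    exact ⟨M.toReal, by rwa [ENNReal.ofReal_toReal hM'.ne]⟩
  refine ⟨⟨fun h => ?_, fun h => ?_⟩, fun h g hg => ?_⟩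
  · obtain ⟨M, hM⟩ := hreal h
    obtain ⟨u, w, hu, hw, hwp, -⟩ := hlower M hM
    exact hu.memSobolev hL hw hwp
  · obtain ⟨u, w, hu, hw, hwp⟩ := PCurvature.MemSobolev.exists_isPrimitive (by simpa using hp.le) hL
      (PCurvature.lipschitzOnWith_of_hasUnitSpeedOn hc).continuousOn h
    refine (PCurvature.pCurvature_le hc hu hw hp hL).trans_lt ?_
    have hfin := hwp.2
    rwa [eLpNorm_lt_top_iff_lintegral_rpow_enorm_lt_top (by simpa using (by linarith : 0 < p))
      ENNReal.ofReal_ne_top, ENNReal.toReal_ofReal (by linarith)] at hfin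
  -- Weak second derivatives are unique almost everywhere, so the given `g` has the same energy as
  -- the one constructed.
  · have heq : ∀ {u w : ℝ → EuclideanSpace ℝ (Fin (N + 1))}, PCurvature.IsPrimitive c u L →
        PCurvature.IsPrimitive u w L →
        ∫⁻ s in Set.Ioo 0 L, ‖w s‖ₑ ^ p = ∫⁻ s in Set.Ioo 0 L, ‖g s‖ₑ ^ p := by
      intro u w hu hw
      refine setLIntegral_congr_fun_ae measurableSet_Ioo ?_
      filter_upwards [((hu.isWeakDeriv hL).trans (hw.isWeakDeriv hL)).ae_eq hg] with s h1 h2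
      rw [h1 h2]
    refine le_antisymm ?_ (le_of_forall_gt fun M hM => ?_)
    · obtain ⟨M, hM⟩ := hreal h
      obtain ⟨u, w, hu, hw, -⟩ := hlower M hM
      exact (PCurvature.pCurvature_le hc hu hw hp hL).trans_eq (heq hu hw)
    -- The lower bound yields a non-strict inequality; an intermediate `M'` makes it strict and is
    -- finite.
    · obtain ⟨M', hM1, hM2⟩ := exists_between hM
      obtain ⟨u, w, hu, hw, -, hle⟩ := hlower M'.toReal (by
        rwa [ENNReal.ofReal_toReal (hM2.trans_le le_top).ne])
      rw [ENNReal.ofReal_toReal (hM2.trans_le le_top).ne] at hle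
      exact ((heq hu hw).symm.le.trans hle).trans_lt hM2
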